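/- Let $d\ge 3$, $\alpha\in(0,1)$. **Hypotheses on $g$.** Let $g:\mathbb R\to\mathbb R$ be odd, continuous and non-decreasing, $g(0)=0$, $g(t)>0$ for $t>0$, $\lim_{t\to+\infty}g(t)=+\infty$, and $G(t)=\int_0^t g(s)\,ds$. Assume that there are $g^-,g^+\in(1,d)$ such that $g^-\le \frac{g(t)t}{G(t)}\le g^+$ for all $t>0$, that $g\in C^1((0,\infty))$ with $g^--1\le\frac{g'(t)t}{g(t)}\le g^+-1$ for all $t>0$, and that $\int_0^1 \frac{G^{-1}(t)}{t^{(d+\alpha)/d}}dt<\infty$, $\int_1^{\infty}\frac{G^{-1}(t)}{t^{(d+\alpha)/d}}dt=\infty$, where $G^{-1}$ is the inverse of $G$ on $[0,\infty)$. Let $G_*$ be the even function given on $[0,\infty)$ by $G_*^{-1}(t)=\int_0^t\frac{G^{-1}(s)}{s^{(d+\alpha)/d}}ds$, and $g_*=G_*'$. **Hypotheses on $K$.** Let $K:\mathbb R^d\to(0,\infty)$ be continuous and bounded, and such that for every sequence $(A_n)$ of Borel sets in $\mathbb R^d$ with $\sup_n |A_n|<\infty$ one has $\lim_{r\to\infty}\int_{A_n\cap\{|x|\ge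 r\}}K\,dx=0$ uniformly in $n$. **Hypotheses on $f$.** Let $f:\mathbb R^d\times\mathbb R\to\mathbb R$ be measurable, $F(x,s)=\int_0^s f(x,t)\,dt$, and assume that for a.e. $x$: $f(x,0)=0$ and $f(x,\cdot)$ is locally Lipschitz; that $\frac{f(x,s)}{g(s)}\to0$ as $|s|\to0^+$, $\frac{f(x,s)}{g_*(s)}\to0$ as $|s|\to\infty$ and $\frac{F(x,s)}{|s|^{g^+}}\to+\infty$ as $s\to\pm\infty$, each uniformly in (a.e.) $x\in\mathbb R^d$; and that for a.e. $x$, all $s\ne0$ and all $\xi$ in Clarke's generalized subdifferential $\partial_s f(x,s)$, $$0<(g^+-1)f(x,s)s<\xi s^2 .$$ **Space and functional.** Let $W^{\alpha,G}(\mathbb R^d)$ be the space of measurable $u:\mathbb R^d\to\mathbb R$ (modulo a.e. equality) with $\int G(u)\,dx<\infty$ and $\iint G\big(\tfrac{u(x)-u(y)}{|x-y|^\alpha}\big)\tfrac{dx\,dy}{|x-y|^d}<\infty$, and for $u,v\in W^{\alpha,G}(\mathbb R^d)$ put $$J(u)=\iint G\Big(\tfrac{u(x)-u(y)}{|x-y|^\alpha}\Big)\tfrac{dx\,dy}{|x-y|^d}+\int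 G(u)\,dx-\int K(x)F(x,u)\,dx,$$ $$\langle J'(u),v\rangle=\iint g\Big(\tfrac{u(x)-u(y)}{|x-y|^\alpha}\Big)\tfrac{v(x)-v(y)}{|x-y|^{\alpha+d}}\,dx\,dy+\int g(u)v\,dx-\int K(x)f(x,u)v\,dx,$$ $$\mathcal N=\{u\in W^{\alpha,G}(\mathbb R^d):u\ne0,\ \langle J'(u),u\rangle=0\}.$$ **Conclusion.** All the integrals in $J(u)$ and $\langle J'(u),v\rangle$ converge absolutely, and $\langle J'(u),v\rangle=\frac{d}{ds}J(u+sv)\big|_{s=0}$, for all $u,v\in W^{\alpha,G}(\mathbb R^d)$. Moreover: 1. For every $u\in W^{\alpha,G}(\mathbb R^d)\setminus\{0\}$ there is a unique $t_u>0$ such that $t_uu\in\mathcal N$. 2. For every $u\in\mathcal N$ and every $t>0$, $J(tu)\le J(u)$; that is, the fibering map $t\mapsto J(tu)$ on $(0,\infty)$ attains its global maximum at $t=1$. -/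

import Mathlib

open MeasureTheory Filter Topology Set

noncomputable section

namespace FracOrlicz

/-- The Euclidean space `ℝ^d`. -/
abbrev E (d : ℕ) : Type := EuclideanSpace ℝ (Fin d)

/-- The primitive `G(t) = ∫₀ᵗ g(s) ds`. -/
def bigG (g : ℝ → ℝ) (t : ℝ) : ℝ := ∫ s in (0 : ℝ)..t, g s

/-- Inverse on `[0, ∞)` of a continuous increasing bijection `Φ` of `[0, ∞)`:
the least `s ≥ 0` with `t ≤ Φ s`. -/
def halfLineInv (Φ : ℝ → ℝ) (t : ℝ) : ℝ := sInf {s : ℝ | 0 ≤ s ∧ t ≤ Φ s}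

/-- `G⁻¹` on `[0, ∞)`. -/
def invG (g : ℝ → ℝ) (t : ℝ) : ℝ := halfLineInv (bigG g) t

/-- The integrand `G⁻¹(s) / s^((d+α)/d)`. -/
def sobolevIntegrand (d : ℕ) (α : ℝ) (g : ℝ → ℝ) (s : ℝ) : ℝ :=
  invG g s / s ^ (((d : ℝ) + α) / (d : ℝ))

/-- The inverse `G_*⁻¹(t) = ∫₀ᵗ G⁻¹(s) / s^((d+α)/d) ds` of the Sobolev conjugate. -/
def invGStar (d : ℕ) (α : ℝ) (g : ℝ → ℝ) (t : ℝ) : ℝ :=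
  ∫ s in (0 : ℝ)..t, sobolevIntegrand d α g s

/-- The Sobolev conjugate `G_*`, an even function on `ℝ`. -/
def GStar (d : ℕ) (α : ℝ) (g : ℝ → ℝ) (t : ℝ) : ℝ :=
  halfLineInv (invGStar d α g) |t|

/-- The density `g_* = G_*'`. -/
def gStar (d : ℕ) (α : ℝ) (g : ℝ → ℝ) (t : ℝ) : ℝ := deriv (GStar d α g) t

/-- Hypothesis `(H_G)` on `g`, with the exponents `gm = g⁻` and `gp = g⁺`. -/
structure HypG (d : ℕ) (α : ℝ) (g : ℝ → ℝ) (gm gp : ℝ) : Prop where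
  odd : ∀ t, g (-t) = - g t
  cont : Continuous g
  mono : Monotone g
  -- `(g₁)`
  pos : ∀ t, 0 < t → 0 < g t
  zero : g 0 = 0
  tendsto_top : Tendsto g atTop atTop
  -- `(g₂)`
  gm_mem : gm ∈ Ioo (1 : ℝ) d
  gp_mem : gp ∈ Ioo (1 : ℝ) d
  growth : ∀ t, 0 < t → gm ≤ g t * t / bigG g t ∧ g t * t / bigG g t ≤ gp
  -- `(g₃)`
  contDiffOn : ContDiffOn ℝ 1 g (Ioi 0)
  growth_deriv : ∀ t, 0 < t →
    gm - 1 ≤ deriv g t * t / g t ∧ deriv g t * t / g t ≤ gp - 1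
  -- `(g₄)`
  int_zero : ∫⁻ t in Ioc (0 : ℝ) 1, ENNReal.ofReal (sobolevIntegrand d α g t) < ⊤
  int_top : ∫⁻ t in Ioi (1 : ℝ), ENNReal.ofReal (sobolevIntegrand d α g t) = ⊤

/-- Hypothesis `(H_K)` on the weight `K`. -/
structure HypK (d : ℕ) (K : E d → ℝ) : Prop where
  cont : Continuous K
  -- `(K₁)`
  pos : ∀ x, 0 < K x
  bdd : MemLp K ⊤ volume
  -- `(K₂)`
  decay : ∀ A : ℕ → Set (E d), (∀ n, MeasurableSet (A n)) →
    (∃ R : ℝ, 0 < R ∧ ∀ n, volume (A n) ≤ ENNReal.ofReal R) →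
    TendstoUniformly (fun (r : ℝ) (n : ℕ) => ∫ x in A n ∩ (Metric.ball 0 r)ᶜ, K x)
      (fun _ => 0) atTop

/-- Clarke's generalized directional derivative
`φ°(u; v) = limsup_{x → u, t ↓ 0} (φ(x + t v) - φ(x)) / t`. -/
def genDirDeriv {X : Type*} [NormedAddCommGroup X] [NormedSpace ℝ X]
    (φ : X → ℝ) (u v : X) : ℝ :=
  limsup (fun p : X × ℝ => (φ (p.1 + p.2 • v) - φ p.1) / p.2) (𝓝 u ×ˢ 𝓝[>] (0 : ℝ))

/-- Clarke's generalized subdifferential `∂φ(u)`, a set of continuous linear functionals. -/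
def genSubdiff {X : Type*} [NormedAddCommGroup X] [NormedSpace ℝ X]
    (φ : X → ℝ) (u : X) : Set (X →L[ℝ] ℝ) :=
  {ξ | ∀ v, ξ v ≤ genDirDeriv φ u v}

/-- The primitive `F(x, s) = ∫₀ˢ f(x, t) dt`. -/
def bigF {d : ℕ} (f : E d → ℝ → ℝ) (x : E d) (s : ℝ) : ℝ := ∫ t in (0 : ℝ)..s, f x t

/-- Hypothesis `(H_f)` on the nonlinearity `f`. A functional `ξ` on `ℝ` is identified with the
real number `ξ 1`. -/
structure HypF (d : ℕ) (α : ℝ) (g : ℝ → ℝ) (gp : ℝ) (f : E d → ℝ → ℝ) : Prop where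
  meas : Measurable (fun p : E d × ℝ => f p.1 p.2)
  zero : ∀ᵐ x : E d, f x 0 = 0
  lip : ∀ᵐ x : E d, LocallyLipschitz (f x)
  -- `(f₁)`
  at_zero : ∀ ε : ℝ, 0 < ε → ∃ δ : ℝ, 0 < δ ∧
    ∀ᵐ x : E d, ∀ s : ℝ, 0 < |s| → |s| < δ → |f x s / g s| < ε
  -- `(f₂)`
  at_top : ∀ ε : ℝ, 0 < ε → ∃ R : ℝ, 0 < R ∧
    ∀ᵐ x : E d, ∀ s : ℝ, R < |s| → |f x s / gStar d α g s| < ε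
  -- `(f₃)`
  superlinear : ∀ M : ℝ, ∃ R : ℝ, 0 < R ∧
    ∀ᵐ x : E d, ∀ s : ℝ, R < |s| → M < bigF f x s / |s| ^ gp
  -- `(f₄)`
  subdiff : ∀ᵐ x : E d, ∀ s : ℝ, 0 < |s| → ∀ ξ ∈ genSubdiff (f x) s,
    0 < (gp - 1) * f x s * s ∧ (gp - 1) * f x s * s < ξ 1 * s ^ 2

/-- The fractional difference quotient `(u(x) - u(y)) / |x - y|^α`. -/
def fracQuot {d : ℕ} (α : ℝ) (u : E d → ℝ) (p : E d × E d) : ℝ :=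
  (u p.1 - u p.2) / ‖p.1 - p.2‖ ^ α

/-- The fractional Orlicz-Sobolev space `W^{α,G}(ℝ^d)`: measurable `u` with
`∫ G(u) dx < ∞` and `∬ G((u(x)-u(y))/|x-y|^α) dx dy / |x-y|^d < ∞` (both integrands are
nonnegative). Its elements are represented by functions; they count as equal when they agree
almost everywhere. -/
def W (d : ℕ) (α : ℝ) (g : ℝ → ℝ) : Set (E d → ℝ) :=
  {u | AEMeasurable u volume ∧
    Integrable (fun x => bigG g (u x)) volume ∧
    Integrable (fun p : E d × E d => bigG g (fracQuot α u p) / ‖p.1 - p.2‖ ^ d)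
      (volume.prod volume)}

/-- The energy functional `J`. -/
def J {d : ℕ} (α : ℝ) (g : ℝ → ℝ) (K : E d → ℝ) (f : E d → ℝ → ℝ) (u : E d → ℝ) : ℝ :=
  (∫ p : E d × E d, bigG g (fracQuot α u p) / ‖p.1 - p.2‖ ^ d ∂(volume.prod volume))
    + (∫ x, bigG g (u x)) - ∫ x, K x * bigF f x (u x)

/-- The pairing `⟨J'(u), v⟩`. -/
def dJ {d : ℕ} (α : ℝ) (g : ℝ → ℝ) (K : E d → ℝ) (f : E d → ℝ → ℝ) (u v : E d → ℝ) : ℝ :=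
  (∫ p : E d × E d, g (fracQuot α u p) * fracQuot α v p / ‖p.1 - p.2‖ ^ d
      ∂(volume.prod volume))
    + (∫ x, g (u x) * v x) - ∫ x, K x * f x (u x) * v x

/-- The Nehari manifold `𝒩 = {u ∈ W^{α,G}(ℝ^d) : u ≠ 0, ⟨J'(u), u⟩ = 0}`. -/
def Nehari {d : ℕ} (α : ℝ) (g : ℝ → ℝ) (K : E d → ℝ) (f : E d → ℝ → ℝ) : Set (E d → ℝ) :=
  {u | u ∈ W d α g ∧ ¬ (u =ᵐ[volume] 0) ∧ dJ α g K f u u = 0}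

end FracOrlicz

end

/-!
The energy is differentiable along lines as soon as the three integrands of `⟨J'(u), v⟩` are
dominated by the modulars `G(u)`, `G(v)`, `G_*(u)`, `G_*(v)`, and the fibering map is then governed
by monotonicity along rays.

The domination rests on the embedding `∫ G_*(u) < ∞` for `u ∈ W^{α,G}`
(`FracOrlicz.HypG.integrable_GStar`), proved directly. Since `g⁺ < d` and `α < 1`, the exponent
`α / d` is smaller than `1 / g⁺`, so `G_*⁻¹(t)` is comparable to `G⁻¹(t) t^{-α/d}`; this yields the
`Δ₂` condition for `G_*`, the bound `s g_*(s) ≤ C G_*(s)`, and the scaling relation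
`G_*(a) ≤ G(a G_*(a)^{α/d})`. For a nonnegative truncation `w` of `|u|` with `∫ G_*(w) ≤ M`,
comparing `w(x) = 8a` with its average over the ball of volume `M / G_*(a)` around `x` gives, by the
scaling relation, `G_*(w(x)) ≤ C M^{α g⁺/d} ∫ G((u(x)-u(y))/|x-y|^α) dy / |x-y|^d`
(`FracOrlicz.HypG.GStar_le_localEnergy`). Integration in `x` bounds `M^{1 - α g⁺/d}` independently of
the truncation.

The condition on Clarke's subdifferential is used only at points where `f(x, ·)` is differentiable,
where the derivative is a subgradient. As `f(x, ·)` is locally absolutely continuous, integrating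
the resulting differential inequality shows that `t ↦ f(x,ts)s / t^{g⁺-1}` is strictly increasing
on `(0, ∞)` for `s ≠ 0` (`FracOrlicz.isSuperpower_of_genSubdiff`), while
`t ↦ g(ts)s / t^{g⁺-1}` is nonincreasing. Hence `⟨J'(tu), u⟩ / t^{g⁺-1}` is strictly decreasing in
`t`. It is positive for small `t`, since `f = o(g)` at the origin, and negative for large `t`, since
`F` grows faster than `|s|^{g⁺}`; both follow by dominated convergence for integrands truncated from
above by a multiple of `g(u)u`, so no comparison between the powers `g⁻` and `g⁺` is needed. The
unique zero is the projection onto the Nehari set, and the sign change there makes it the global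
maximum of `t ↦ J(tu)`.
-/

open MeasureTheory Filter Topology Set

noncomputable section

namespace FracOrlicz

/-! ### Functions with power-type growth -/

/-- Bounds on the logarithmic derivative `s h'(s) / h(s)` amount to monotonicity of the quotient of
`h` by a power. -/
theorem antitoneOn_div_rpow {h h' : ℝ → ℝ} {M : ℝ} (hd : ∀ s, 0 < s → HasDerivAt h (h' s) s)
    (hM : ∀ s, 0 < s → s * h' s ≤ M * h s) : AntitoneOn (fun s => h s / s ^ M) (Ioi 0) := by
  have hder : ∀ s ∈ Ioi (0 : ℝ), HasDerivAt (fun s => h s / s ^ M)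
      ((h' s * s ^ M - h s * (M * s ^ (M - 1))) / (s ^ M) ^ 2) s := fun s hs =>
    (hd s hs).div (Real.hasDerivAt_rpow_const (Or.inl (ne_of_gt hs)))
      (Real.rpow_pos_of_pos hs _).ne'
  refine antitoneOn_of_deriv_nonpos (convex_Ioi 0)
    (fun s hs => (hder s hs).continuousAt.continuousWithinAt)
    (fun s hs => (hder s (interior_subset hs)).differentiableAt.differentiableWithinAt) ?_
  intro s hs
  have hs0 : 0 < s := interior_subset hs
  rw [(hder s hs0).deriv]
  refine div_nonpos_of_nonpos_of_nonneg ?_ (sq_nonneg _)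
  have e : s ^ M = s ^ (M - 1) * s := by rw [Real.rpow_sub_one hs0.ne']; field_simp
  have h1 := hM s hs0
  have h2 : 0 < s ^ (M - 1) := Real.rpow_pos_of_pos hs0 _
  rw [e]
  nlinarith

theorem monotoneOn_div_rpow {h h' : ℝ → ℝ} {m : ℝ} (hd : ∀ s, 0 < s → HasDerivAt h (h' s) s)
    (hm : ∀ s, 0 < s → m * h s ≤ s * h' s) : MonotoneOn (fun s => h s / s ^ m) (Ioi 0) := by
  have := antitoneOn_div_rpow (h := fun s => - h s) (h' := fun s => - h' s) (M := m)
    (fun s hs => (hd s hs).neg) (fun s hs => by have := hm s hs; linarith)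
  intro a ha b hb hab
  have := this ha hb hab
  simp only [neg_div] at this
  exact neg_le_neg_iff.1 this

/-! ### Inverses on the half-line -/

section Inverse
variable {Φ : ℝ → ℝ}

/-- A strictly increasing continuous bijection of `[0, ∞)`. -/
structure IsHalfLineHomeo (Φ : ℝ → ℝ) : Prop where
  cont : ContinuousOn Φ (Ici 0)
  mono : StrictMonoOn Φ (Ici 0)
  zero : Φ 0 = 0
  top : Tendsto Φ atTop atTop

theorem halfLineInv_left (hΦ : IsHalfLineHomeo Φ) {s : ℝ} (hs : 0 ≤ s) :
    halfLineInv Φ (Φ s) = s := by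
  have : {r : ℝ | 0 ≤ r ∧ Φ s ≤ Φ r} = Ici s := by
    ext r
    constructor
    · rintro ⟨h0, h1⟩
      exact (hΦ.mono.le_iff_le hs h0).1 h1
    · intro h
      exact ⟨hs.trans h, (hΦ.mono.le_iff_le hs (hs.trans h)).2 h⟩
  rw [halfLineInv, this, csInf_Ici]

theorem IsHalfLineHomeo.surj (hΦ : IsHalfLineHomeo Φ) {t : ℝ} (ht : 0 ≤ t) :
    ∃ s, 0 ≤ s ∧ Φ s = t := by
  obtain ⟨b, hb, hb0⟩ := ((hΦ.top.eventually_ge_atTop t).and (eventually_ge_atTop 0)).exists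
  obtain ⟨s, hs, h⟩ := intermediate_value_Icc hb0
    (hΦ.cont.mono (fun x hx => hx.1)) (show t ∈ Icc (Φ 0) (Φ b) from ⟨hΦ.zero.trans_le ht, hb⟩)
  exact ⟨s, hs.1, h⟩

theorem halfLineInv_nonneg (Φ : ℝ → ℝ) (t : ℝ) : 0 ≤ halfLineInv Φ t :=
  Real.sInf_nonneg fun _ h => h.1

theorem halfLineInv_right (hΦ : IsHalfLineHomeo Φ) {t : ℝ} (ht : 0 ≤ t) :
    Φ (halfLineInv Φ t) = t := by
  obtain ⟨s, hs, rfl⟩ := hΦ.surj ht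
  rw [halfLineInv_left hΦ hs]

theorem IsHalfLineHomeo.pos (hΦ : IsHalfLineHomeo Φ) {s : ℝ} (hs : 0 < s) : 0 < Φ s := by
  have := hΦ.mono (self_mem_Ici) hs.le hs
  rwa [hΦ.zero] at this

theorem halfLineInv_homeo (hΦ : IsHalfLineHomeo Φ) : IsHalfLineHomeo (halfLineInv Φ) := by
  have hm : StrictMonoOn (halfLineInv Φ) (Ici 0) := by
    intro a ha b hb hab
    refine (hΦ.mono.lt_iff_lt (halfLineInv_nonneg _ _) (halfLineInv_nonneg _ _)).1 ?_
    rwa [halfLineInv_right hΦ ha, halfLineInv_right hΦ hb]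
  have h0 : halfLineInv Φ 0 = 0 := by
    conv_lhs => rw [← hΦ.zero]
    exact halfLineInv_left hΦ le_rfl
  have him : halfLineInv Φ '' Ici 0 = Ici 0 := by
    ext s
    constructor
    · rintro ⟨t, -, rfl⟩
      exact halfLineInv_nonneg _ _
    · intro hs
      refine ⟨Φ s, ?_, halfLineInv_left hΦ hs⟩
      rcases eq_or_lt_of_le (show (0 : ℝ) ≤ s from hs) with h | h
      · rw [← h, hΦ.zero]; exact self_mem_Ici
      · exact (hΦ.pos h).le
  refine ⟨?_, hm, h0, ?_⟩
  · intro t ht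
    rcases eq_or_lt_of_le (show (0 : ℝ) ≤ t from ht) with h | h
    · subst h
      refine hm.continuousWithinAt_right_of_surjOn self_mem_nhdsWithin ?_
      rw [h0]
      intro s hs
      rw [him]
      exact (show (0 : ℝ) < s from hs).le
    · refine (hm.continuousAt_of_image_mem_nhds (Ici_mem_nhds h) ?_).continuousWithinAt
      rw [him]
      refine Ici_mem_nhds ?_
      have := hm self_mem_Ici ht h
      rwa [h0] at this
  · refine tendsto_atTop.2 fun b => ?_
    filter_upwards [eventually_ge_atTop (Φ (max b 0)), eventually_ge_atTop 0] with t ht ht0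
    refine (le_max_left b 0).trans ?_
    rw [← halfLineInv_left hΦ (le_max_right b 0)]
    refine hm.monotoneOn ?_ ht0 ht
    rcases eq_or_lt_of_le (le_max_right b 0) with h | h
    · rw [← h, hΦ.zero]; exact self_mem_Ici
    · exact (hΦ.pos h).le

end Inverse

/-! ### The Young function `G` -/

section Young
variable {d : ℕ} {α : ℝ} {g : ℝ → ℝ} {gm gp : ℝ}

theorem HypG.hasDerivAt (hG : HypG d α g gm gp) (t : ℝ) : HasDerivAt (bigG g) (g t) t :=
  intervalIntegral.integral_hasDerivAt_right (hG.cont.intervalIntegrable _ _)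
    (hG.cont.stronglyMeasurableAtFilter _ _) hG.cont.continuousAt

theorem HypG.continuous_bigG (hG : HypG d α g gm gp) : Continuous (bigG g) :=
  continuous_iff_continuousAt.2 fun t => (hG.hasDerivAt t).continuousAt

theorem bigG_zero : bigG g 0 = 0 := by simp [bigG]

theorem HypG.bigG_neg (hG : HypG d α g gm gp) (t : ℝ) : bigG g (-t) = bigG g t := by
  have h := intervalIntegral.integral_comp_neg (a := 0) (b := t) (fun s => g s)
  simp only [hG.odd, neg_zero, intervalIntegral.integral_neg] at h
  rw [bigG, bigG, intervalIntegral.integral_symm, ← h, neg_neg]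

theorem HypG.bigG_abs (hG : HypG d α g gm gp) (t : ℝ) : bigG g |t| = bigG g t := by
  rcases abs_choice t with h | h <;> rw [h]
  exact hG.bigG_neg t

theorem HypG.strictMonoOn_bigG (hG : HypG d α g gm gp) : StrictMonoOn (bigG g) (Ici 0) :=
  strictMonoOn_of_deriv_pos (convex_Ici 0) hG.continuous_bigG.continuousOn fun t ht => by
    rw [interior_Ici] at ht
    rw [(hG.hasDerivAt t).deriv]
    exact hG.pos t ht

theorem HypG.bigG_pos (hG : HypG d α g gm gp) {t : ℝ} (ht : t ≠ 0) : 0 < bigG g t := by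
  rw [← hG.bigG_abs]
  have := hG.strictMonoOn_bigG self_mem_Ici (abs_nonneg t) (abs_pos.2 ht)
  rwa [bigG_zero] at this

theorem HypG.bigG_nonneg (hG : HypG d α g gm gp) (t : ℝ) : 0 ≤ bigG g t := by
  rcases eq_or_ne t 0 with rfl | h
  · rw [bigG_zero]
  · exact (hG.bigG_pos h).le

theorem HypG.bigG_le (hG : HypG d α g gm gp) {s t : ℝ} (h : |s| ≤ |t|) : bigG g s ≤ bigG g t := by
  rw [← hG.bigG_abs s, ← hG.bigG_abs t]
  exact hG.strictMonoOn_bigG.monotoneOn (abs_nonneg s) (abs_nonneg t) h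

theorem HypG.mul_g_le (hG : HypG d α g gm gp) {t : ℝ} (ht : 0 ≤ t) : t * g t ≤ gp * bigG g t := by
  rcases eq_or_lt_of_le ht with rfl | h
  · simp [bigG_zero]
  · have := (div_le_iff₀ (hG.bigG_pos h.ne')).1 (hG.growth t h).2
    linarith

theorem HypG.le_mul_g (hG : HypG d α g gm gp) {t : ℝ} (ht : 0 ≤ t) : gm * bigG g t ≤ t * g t := by
  rcases eq_or_lt_of_le ht with rfl | h
  · simp [bigG_zero]
  · have := (le_div_iff₀ (hG.bigG_pos h.ne')).1 (hG.growth t h).1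
    linarith

theorem HypG.antitoneOn_bigG (hG : HypG d α g gm gp) :
    AntitoneOn (fun s => bigG g s / s ^ gp) (Ioi 0) :=
  antitoneOn_div_rpow (fun s _ => hG.hasDerivAt s) fun _ hs => hG.mul_g_le (le_of_lt hs)

/-- `G(λt) ≤ λ^{g⁺} G(t)` for `λ ≥ 1`. -/
theorem HypG.bigG_mul_le (hG : HypG d α g gm gp) {l t : ℝ} (hl : 1 ≤ l) (ht : 0 ≤ t) :
    bigG g (l * t) ≤ l ^ gp * bigG g t := by
  rcases eq_or_lt_of_le ht with rfl | h
  · simp [bigG_zero]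
  · have hl0 : 0 < l := one_pos.trans_le hl
    have := hG.antitoneOn_bigG h (mul_pos hl0 h) (le_mul_of_one_le_left ht hl)
    simp only at this
    rw [Real.mul_rpow hl0.le ht, div_le_div_iff₀ (by positivity) (by positivity)] at this
    have h2 : 0 < t ^ gp := Real.rpow_pos_of_pos h _
    nlinarith

/-- `G(λt) ≥ λ G(t)` for `λ ≥ 1`, by convexity. -/
theorem HypG.le_bigG_mul (hG : HypG d α g gm gp) {l t : ℝ} (hl : 1 ≤ l) (ht : 0 ≤ t) :
    l * bigG g t ≤ bigG g (l * t) := by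
  rcases eq_or_lt_of_le ht with rfl | h
  · simp [bigG_zero]
  · have hl0 : 0 < l := one_pos.trans_le hl
    have := monotoneOn_div_rpow (m := 1) (fun s _ => hG.hasDerivAt s) (fun s hs => by
      have := hG.le_mul_g hs.le
      have := hG.bigG_nonneg s
      have := hG.gm_mem.1
      nlinarith) h (mul_pos hl0 h) (le_mul_of_one_le_left ht hl)
    simp only [Real.rpow_one] at this
    rw [div_le_div_iff₀ (by positivity) (by positivity)] at this
    nlinarith

theorem HypG.bigG_add_le (hG : HypG d α g gm gp) (s t : ℝ) :
    bigG g (|s| + |t|) ≤ 2 ^ gp * (bigG g s + bigG g t) := by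
  have h1 : bigG g (|s| + |t|) ≤ bigG g (2 * max |s| |t|) := by
    refine hG.bigG_le ?_
    have hm : 0 ≤ max |s| |t| := (abs_nonneg s).trans (le_max_left _ _)
    rw [abs_of_nonneg (show 0 ≤ |s| + |t| by positivity),
      abs_of_nonneg (show 0 ≤ 2 * max |s| |t| by positivity)]
    linarith [le_max_left |s| |t|, le_max_right |s| |t|]
  refine (h1.trans (hG.bigG_mul_le one_le_two
    ((abs_nonneg s).trans (le_max_left _ _)))).trans ?_
  gcongr
  rcases max_choice |s| |t| with h | h <;> rw [h, hG.bigG_abs] <;>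
    linarith [hG.bigG_nonneg s, hG.bigG_nonneg t]

theorem HypG.tendsto_bigG (hG : HypG d α g gm gp) : Tendsto (bigG g) atTop atTop := by
  have h : Tendsto (fun t => t * bigG g 1) atTop atTop :=
    tendsto_id.atTop_mul_const (hG.bigG_pos one_ne_zero)
  refine tendsto_atTop_mono' _ ?_ h
  filter_upwards [eventually_ge_atTop 1] with t ht
  simpa using hG.le_bigG_mul ht zero_le_one

theorem HypG.homeo_bigG (hG : HypG d α g gm gp) : IsHalfLineHomeo (bigG g) :=
  ⟨hG.continuous_bigG.continuousOn, hG.strictMonoOn_bigG, bigG_zero, hG.tendsto_bigG⟩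

theorem HypG.g_nonneg (hG : HypG d α g gm gp) {t : ℝ} (ht : 0 ≤ t) : 0 ≤ g t :=
  hG.zero ▸ hG.mono ht

theorem HypG.abs_g_le (hG : HypG d α g gm gp) {s t : ℝ} (h : |s| ≤ t) : |g s| ≤ g t := by
  rw [abs_le] at h ⊢
  exact ⟨by rw [← hG.odd]; exact hG.mono h.1, hG.mono h.2⟩

/-- The domination used when differentiating modulars. -/
theorem HypG.abs_g_mul_le (hG : HypG d α g gm gp) {a b s : ℝ} (hs : |s| ≤ 1) :
    |g (a + s * b) * b| ≤ gp * 2 ^ gp * (bigG g a + bigG g b) := by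
  have h1 : |a + s * b| ≤ |a| + |b| := (abs_add_le _ _).trans (by
    rw [abs_mul]; gcongr; exact mul_le_of_le_one_left (abs_nonneg b) hs)
  have hg0 : 0 ≤ g (|a| + |b|) := hG.g_nonneg (by positivity)
  have hgp : 0 < gp := one_pos.trans hG.gp_mem.1
  calc |g (a + s * b) * b| ≤ g (|a| + |b|) * (|a| + |b|) := by
        rw [abs_mul]
        gcongr
        · exact hG.abs_g_le h1
        · linarith [abs_nonneg a]
    _ = (|a| + |b|) * g (|a| + |b|) := mul_comm _ _
    _ ≤ gp * bigG g (|a| + |b|) := hG.mul_g_le (by positivity)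
    _ ≤ gp * (2 ^ gp * (bigG g a + bigG g b)) := by gcongr; exact hG.bigG_add_le a b
    _ = _ := by ring

theorem HypG.g_mul_abs (hG : HypG d α g gm gp) (s : ℝ) : g |s| * |s| = g s * s := by
  rcases abs_choice s with h | h <;> rw [h]
  rw [hG.odd]; ring

theorem HypG.g_mul_pos (hG : HypG d α g gm gp) {s : ℝ} (hs : s ≠ 0) : 0 < g s * s := by
  rw [← hG.g_mul_abs]
  exact mul_pos (hG.pos _ (abs_pos.2 hs)) (abs_pos.2 hs)

theorem HypG.g_mul_nonneg (hG : HypG d α g gm gp) (s : ℝ) : 0 ≤ g s * s := by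
  rcases eq_or_ne s 0 with rfl | h
  · simp
  · exact (hG.g_mul_pos h).le

/-- Along every ray, `t ↦ g(ts)s / t^{g⁺-1}` is nonincreasing. -/
theorem HypG.antitoneOn_ray (hG : HypG d α g gm gp) (s : ℝ) :
    AntitoneOn (fun t => g (t * s) * s / t ^ (gp - 1)) (Ioi 0) := by
  rcases eq_or_ne s 0 with rfl | h
  · simp only [mul_zero, zero_div]; exact antitoneOn_const
  have key : AntitoneOn (fun s => g s / s ^ (gp - 1)) (Ioi 0) := by
    refine antitoneOn_div_rpow (h' := deriv g) (fun t ht => ?_) fun t ht => ?_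
    · exact ((hG.contDiffOn.differentiableOn one_ne_zero).differentiableAt
        (Ioi_mem_nhds ht)).hasDerivAt
    · have := (div_le_iff₀ (hG.pos t ht)).1 (hG.growth_deriv t ht).2
      linarith
  have hs : 0 < |s| := abs_pos.2 h
  have e : ∀ t, 0 < t → g (t * s) * s / t ^ (gp - 1) =
      (g (t * |s|) / (t * |s|) ^ (gp - 1)) * (|s| * |s| ^ (gp - 1)) := by
    intro t ht
    have h1 : g (t * s) * s = g (t * |s|) * |s| := by
      have := hG.g_mul_abs (t * s)
      rw [abs_mul, abs_of_pos ht] at this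
      have h2 : t * (g (t * s) * s) = t * (g (t * |s|) * |s|) := by linarith
      exact mul_left_cancel₀ ht.ne' h2
    rw [h1, Real.mul_rpow ht.le hs.le]
    have : 0 < |s| ^ (gp - 1) := Real.rpow_pos_of_pos hs _
    have : 0 < t ^ (gp - 1) := Real.rpow_pos_of_pos ht _
    field_simp
  intro a ha b hb hab
  simp only
  rw [e a ha, e b hb]
  refine mul_le_mul_of_nonneg_right ?_ (by positivity)
  exact key (mul_pos ha hs) (mul_pos hb hs) (by gcongr)

end Young

/-! ### The Sobolev conjugate `G_*` -/

section Conjugate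
variable {d : ℕ} {α : ℝ} {g : ℝ → ℝ} {gm gp : ℝ}

theorem HypG.homeo_invG (hG : HypG d α g gm gp) : IsHalfLineHomeo (invG g) :=
  halfLineInv_homeo hG.homeo_bigG

theorem HypG.bigG_invG (hG : HypG d α g gm gp) {t : ℝ} (ht : 0 ≤ t) : bigG g (invG g t) = t :=
  halfLineInv_right hG.homeo_bigG ht

theorem HypG.gp_pos (hG : HypG d α g gm gp) : 0 < gp := one_pos.trans hG.gp_mem.1

theorem HypG.invG_le (hG : HypG d α g gm gp) {s t : ℝ} (hs : 0 < s) (hst : s ≤ t) :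
    invG g s ≤ (s / t) ^ (1 / gp) * invG g t := by
  have ht := hs.trans_le hst
  have h0 : 0 ≤ invG g s := halfLineInv_nonneg _ _
  have h1 : 1 ≤ (t / s) ^ (1 / gp) :=
    Real.one_le_rpow ((one_le_div hs).2 hst) (by have := hG.gp_pos; positivity)
  have h2 : bigG g ((t / s) ^ (1 / gp) * invG g s) ≤ bigG g (invG g t) := by
    refine (hG.bigG_mul_le h1 h0).trans ?_
    rw [hG.bigG_invG hs.le, hG.bigG_invG ht.le, ← Real.rpow_mul (by positivity),
      one_div_mul_cancel hG.gp_pos.ne', Real.rpow_one, div_mul_cancel₀ _ hs.ne']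
  have h3 := (hG.strictMonoOn_bigG.le_iff_le (show (0 : ℝ) ≤ _ by positivity)
    (halfLineInv_nonneg _ _)).1 h2
  rw [← inv_div, Real.inv_rpow (by positivity), ← div_eq_inv_mul, le_div_iff₀' (by positivity)]
  exact h3

theorem HypG.invG_div_antitone (hG : HypG d α g gm gp) {s t : ℝ} (hs : 0 < s) (hst : s ≤ t) :
    invG g t / t ≤ invG g s / s := by
  have ht := hs.trans_le hst
  have h0 : 0 ≤ invG g s := halfLineInv_nonneg _ _
  have h2 : bigG g (invG g t) ≤ bigG g (t / s * invG g s) := by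
    refine le_trans ?_ (hG.le_bigG_mul ((one_le_div hs).2 hst) h0)
    rw [hG.bigG_invG hs.le, hG.bigG_invG ht.le, div_mul_cancel₀ _ hs.ne']
  have h3 := (hG.strictMonoOn_bigG.le_iff_le (halfLineInv_nonneg _ _)
    (show (0 : ℝ) ≤ _ by positivity)).1 h2
  rw [div_le_iff₀ ht]
  refine h3.trans (le_of_eq ?_)
  ring

theorem HypG.invG_pos (hG : HypG d α g gm gp) {t : ℝ} (ht : 0 < t) : 0 < invG g t :=
  hG.homeo_invG.pos ht

theorem sobolevIntegrand_eq (hd : 3 ≤ d) (s : ℝ) :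
    sobolevIntegrand d α g s = invG g s / s ^ (1 + α / d) := by
  have : (d : ℝ) ≠ 0 := by positivity
  rw [sobolevIntegrand, add_div, div_self this]

/-- Since `g⁺ < d` and `α < 1`, the problem is subcritical: `α / d < 1 / g⁺`. -/
theorem HypG.subcritical (hG : HypG d α g gm gp) (hα : α ∈ Ioo (0 : ℝ) 1) :
    α / d < 1 / gp := by
  have h := hG.gp_mem
  have hgp := hG.gp_pos
  rw [div_lt_div_iff₀ (hgp.trans h.2) hgp]
  nlinarith [hα.1, hα.2, h.2]

theorem HypG.sobolevIntegrand_pos (hG : HypG d α g gm gp) {s : ℝ} (hs : 0 < s) :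
    0 < sobolevIntegrand d α g s :=
  div_pos (hG.invG_pos hs) (Real.rpow_pos_of_pos hs _)

theorem HypG.sobolevIntegrand_antitone (hG : HypG d α g gm gp) (hd : 3 ≤ d)
    (hα : α ∈ Ioo (0 : ℝ) 1) {s t : ℝ} (hs : 0 < s) (hst : s ≤ t) :
    sobolevIntegrand d α g t ≤ sobolevIntegrand d α g s := by
  have ht := hs.trans_le hst
  have hb : 0 ≤ α / d := div_nonneg hα.1.le (Nat.cast_nonneg d)
  have h0 := hG.invG_pos hs
  rw [sobolevIntegrand_eq hd, sobolevIntegrand_eq hd, Real.rpow_add hs, Real.rpow_add ht,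
    Real.rpow_one, Real.rpow_one, ← div_div, ← div_div]
  have := hG.invG_div_antitone hs hst
  have h2 : 0 < s ^ (α / d) := Real.rpow_pos_of_pos hs _
  gcongr

theorem HypG.sobolevIntegrand_le (hG : HypG d α g gm gp) (hd : 3 ≤ d) {s t : ℝ} (hs : 0 < s)
    (hst : s ≤ t) : sobolevIntegrand d α g s ≤
      invG g t / t ^ (1 / gp) * s ^ (1 / gp - α / d - 1) := by
  have ht := hs.trans_le hst
  have e : s ^ (1 / gp - α / d - 1) = s ^ (1 / gp) / s ^ (1 + α / d) := by
    rw [← Real.rpow_sub hs]; congr 1; ring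
  rw [sobolevIntegrand_eq hd, e, ← mul_div_assoc]
  have h2 : 0 < s ^ (1 + α / d) := Real.rpow_pos_of_pos hs _
  gcongr
  refine (hG.invG_le hs hst).trans (le_of_eq ?_)
  rw [Real.div_rpow hs.le ht.le]
  ring

theorem HypG.continuousOn_sobolevIntegrand (hG : HypG d α g gm gp) :
    ContinuousOn (sobolevIntegrand d α g) (Ioi 0) := by
  refine (hG.homeo_invG.cont.mono Ioi_subset_Ici_self).div ?_ fun s hs =>
    (Real.rpow_pos_of_pos hs _).ne'
  exact fun s hs => (Real.continuousAt_rpow_const _ _ (Or.inl (ne_of_gt hs))).continuousWithinAt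

theorem HypG.intervalIntegrable_sobolevIntegrand (hG : HypG d α g gm gp) (hd : 3 ≤ d)
    (hα : α ∈ Ioo (0 : ℝ) 1) {t : ℝ} (ht : 0 ≤ t) :
    IntervalIntegrable (sobolevIntegrand d α g) volume 0 t := by
  have h1 : IntervalIntegrable (fun s : ℝ => invG g t / t ^ (1 / gp) * s ^ (1 / gp - α / d - 1))
      volume 0 t :=
    (intervalIntegral.intervalIntegrable_rpow' (by linarith [hG.subcritical hα])).const_mul _
  rw [intervalIntegrable_iff_integrableOn_Ioc_of_le ht] at h1 ⊢
  refine Integrable.mono' h1 ((hG.continuousOn_sobolevIntegrand.mono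
    Ioc_subset_Ioi_self).aestronglyMeasurable measurableSet_Ioc) ?_
  refine (ae_restrict_iff' measurableSet_Ioc).2 (Eventually.of_forall fun s hs => ?_)
  rw [Real.norm_of_nonneg (hG.sobolevIntegrand_pos hs.1).le]
  exact hG.sobolevIntegrand_le hd hs.1 hs.2

theorem HypG.le_invGStar (hG : HypG d α g gm gp) (hd : 3 ≤ d)
    (hα : α ∈ Ioo (0 : ℝ) 1) {t : ℝ} (ht : 0 < t) :
    t * sobolevIntegrand d α g t ≤ invGStar d α g t := by
  have := intervalIntegral.integral_mono_on_of_le_Ioo (f := fun _ => sobolevIntegrand d α g t)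
    (μ := volume) ht.le intervalIntegrable_const
    (hG.intervalIntegrable_sobolevIntegrand hd hα ht.le)
    (fun s hs => hG.sobolevIntegrand_antitone hd hα hs.1 hs.2.le)
  simpa [invGStar] using this

theorem HypG.invGStar_le (hG : HypG d α g gm gp) (hd : 3 ≤ d)
    (hα : α ∈ Ioo (0 : ℝ) 1) {t : ℝ} (ht : 0 < t) :
    invGStar d α g t ≤ (1 / gp - α / d)⁻¹ * (t * sobolevIntegrand d α g t) := by
  have hsub : 0 < 1 / gp - α / d := by linarith [hG.subcritical hα]
  have := intervalIntegral.integral_mono_on_of_le_Ioo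
    (g := fun s : ℝ => invG g t / t ^ (1 / gp) * s ^ (1 / gp - α / d - 1))
    (μ := volume) ht.le (hG.intervalIntegrable_sobolevIntegrand hd hα ht.le)
    ((intervalIntegral.intervalIntegrable_rpow' (by linarith)).const_mul _)
    (fun s hs => hG.sobolevIntegrand_le hd hs.1 hs.2.le)
  refine this.trans (le_of_eq ?_)
  rw [intervalIntegral.integral_const_mul, integral_rpow (Or.inl (by linarith)),
    sobolevIntegrand_eq hd, sub_add_cancel, Real.zero_rpow hsub.ne', sub_zero,
    Real.rpow_sub ht, Real.rpow_add ht, Real.rpow_one]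
  have h1 : 0 < t ^ (1 / gp) := Real.rpow_pos_of_pos ht _
  have h2 : 0 < t ^ (α / d) := Real.rpow_pos_of_pos ht _
  field_simp

theorem HypG.hasDerivAt_invGStar (hG : HypG d α g gm gp) (hd : 3 ≤ d)
    (hα : α ∈ Ioo (0 : ℝ) 1) {t : ℝ} (ht : 0 < t) :
    HasDerivAt (invGStar d α g) (sobolevIntegrand d α g t) t :=
  intervalIntegral.integral_hasDerivAt_right
    (hG.intervalIntegrable_sobolevIntegrand hd hα ht.le)
    (hG.continuousOn_sobolevIntegrand.stronglyMeasurableAtFilter isOpen_Ioi t ht)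
    (hG.continuousOn_sobolevIntegrand.continuousAt (Ioi_mem_nhds ht))

theorem HypG.homeo_invGStar (hG : HypG d α g gm gp) (hd : 3 ≤ d)
    (hα : α ∈ Ioo (0 : ℝ) 1) : IsHalfLineHomeo (invGStar d α g) := by
  have hc : ContinuousOn (invGStar d α g) (Ici 0) := by
    intro t ht
    have h1 := hG.intervalIntegrable_sobolevIntegrand hd hα
      (show (0 : ℝ) ≤ t + 1 by linarith [show (0 : ℝ) ≤ t from ht])
    have h2 := intervalIntegral.continuousOn_primitive_interval' h1 left_mem_uIcc
    rw [uIcc_of_le (by linarith [show (0 : ℝ) ≤ t from ht])] at h2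
    refine (h2 t ⟨ht, by linarith⟩).mono_of_mem_nhdsWithin ?_
    rw [← Ici_inter_Iic]
    exact inter_mem self_mem_nhdsWithin (mem_nhdsWithin_of_mem_nhds (Iic_mem_nhds (by linarith)))
  refine ⟨hc, strictMonoOn_of_deriv_pos (convex_Ici 0) hc fun t ht => ?_, by simp [invGStar], ?_⟩
  · rw [interior_Ici] at ht
    rw [(hG.hasDerivAt_invGStar hd hα ht).deriv]
    exact hG.sobolevIntegrand_pos ht
  · have hsub : 0 < 1 / gp - α / d := by linarith [hG.subcritical hα]
    have h1 : Tendsto (fun t : ℝ => t ^ (1 / gp - α / d) * invG g 1) atTop atTop :=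
      (tendsto_rpow_atTop hsub).atTop_mul_const (hG.invG_pos one_pos)
    refine tendsto_atTop_mono' _ ?_ h1
    filter_upwards [eventually_ge_atTop 1] with t ht
    have ht0 : 0 < t := by linarith
    refine le_trans ?_ (hG.le_invGStar hd hα ht0)
    have h2 := hG.invG_le one_pos ht
    rw [Real.div_rpow zero_le_one ht0.le, Real.one_rpow] at h2
    rw [sobolevIntegrand_eq hd, Real.rpow_sub ht0, Real.rpow_add ht0, Real.rpow_one]
    have h3 : 0 < t ^ (1 / gp) := Real.rpow_pos_of_pos ht0 _
    have h4 : 0 < t ^ (α / d) := Real.rpow_pos_of_pos ht0 _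
    have h5 : t ^ (1 / gp) * invG g 1 ≤ invG g t := by
      rw [one_div, ← div_eq_inv_mul, le_div_iff₀' h3] at h2
      exact h2
    calc t ^ (1 / gp) / t ^ (α / d) * invG g 1 = (t ^ (1 / gp) * invG g 1) / t ^ (α / d) := by ring
      _ ≤ invG g t / t ^ (α / d) := by gcongr
      _ = _ := by field_simp

theorem GStar_neg (t : ℝ) : GStar d α g (-t) = GStar d α g t := by rw [GStar, abs_neg]; rfl

theorem GStar_abs (t : ℝ) : GStar d α g |t| = GStar d α g t := by rw [GStar, abs_abs]; rfl

theorem GStar_nonneg (t : ℝ) : 0 ≤ GStar d α g t := halfLineInv_nonneg _ _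

theorem HypG.continuous_GStar (hG : HypG d α g gm gp) (hd : 3 ≤ d)
    (hα : α ∈ Ioo (0 : ℝ) 1) : Continuous (GStar d α g) :=
  (halfLineInv_homeo (hG.homeo_invGStar hd hα)).cont.comp_continuous continuous_abs abs_nonneg

theorem HypG.GStar_le (hG : HypG d α g gm gp) (hd : 3 ≤ d)
    (hα : α ∈ Ioo (0 : ℝ) 1) {s t : ℝ} (h : |s| ≤ |t|) : GStar d α g s ≤ GStar d α g t :=
  (halfLineInv_homeo (hG.homeo_invGStar hd hα)).mono.monotoneOn (abs_nonneg s) (abs_nonneg t) h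

theorem HypG.GStar_zero (hG : HypG d α g gm gp) (hd : 3 ≤ d)
    (hα : α ∈ Ioo (0 : ℝ) 1) : GStar d α g 0 = 0 := by
  rw [GStar, abs_zero, (halfLineInv_homeo (hG.homeo_invGStar hd hα)).zero]

theorem HypG.GStar_pos (hG : HypG d α g gm gp) (hd : 3 ≤ d)
    (hα : α ∈ Ioo (0 : ℝ) 1) {t : ℝ} (ht : 0 < t) : 0 < GStar d α g t := by
  rw [← GStar_abs, GStar, abs_abs]
  exact (halfLineInv_homeo (hG.homeo_invGStar hd hα)).pos (abs_pos.2 ht.ne')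

theorem HypG.invGStar_GStar (hG : HypG d α g gm gp) (hd : 3 ≤ d)
    (hα : α ∈ Ioo (0 : ℝ) 1) {t : ℝ} (ht : 0 ≤ t) : invGStar d α g (GStar d α g t) = t := by
  rw [GStar, halfLineInv_right (hG.homeo_invGStar hd hα) (abs_nonneg t), abs_of_nonneg ht]

theorem HypG.GStar_invGStar (hG : HypG d α g gm gp) (hd : 3 ≤ d)
    (hα : α ∈ Ioo (0 : ℝ) 1) {t : ℝ} (ht : 0 < t) : GStar d α g (invGStar d α g t) = t := by
  rw [GStar, abs_of_pos ((hG.homeo_invGStar hd hα).pos ht),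
    halfLineInv_left (hG.homeo_invGStar hd hα) ht.le]

theorem HypG.hasDerivAt_GStar (hG : HypG d α g gm gp) (hd : 3 ≤ d)
    (hα : α ∈ Ioo (0 : ℝ) 1) {t : ℝ} (ht : 0 < t) :
    HasDerivAt (GStar d α g) (sobolevIntegrand d α g (GStar d α g t))⁻¹ t := by
  have hp := hG.GStar_pos hd hα ht
  refine HasDerivAt.of_local_left_inverse (hG.continuous_GStar hd hα).continuousAt
    (hG.hasDerivAt_invGStar hd hα hp) (hG.sobolevIntegrand_pos hp).ne' ?_
  filter_upwards [Ioi_mem_nhds ht] with s hs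
  exact hG.invGStar_GStar hd hα (le_of_lt hs)

theorem HypG.gStar_eq (hG : HypG d α g gm gp) (hd : 3 ≤ d)
    (hα : α ∈ Ioo (0 : ℝ) 1) {t : ℝ} (ht : 0 < t) :
    gStar d α g t = (sobolevIntegrand d α g (GStar d α g t))⁻¹ :=
  (hG.hasDerivAt_GStar hd hα ht).deriv

theorem HypG.gStar_pos (hG : HypG d α g gm gp) (hd : 3 ≤ d)
    (hα : α ∈ Ioo (0 : ℝ) 1) {t : ℝ} (ht : 0 < t) : 0 < gStar d α g t := by
  rw [hG.gStar_eq hd hα ht]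
  exact inv_pos.2 (hG.sobolevIntegrand_pos (hG.GStar_pos hd hα ht))

theorem gStar_neg (t : ℝ) : gStar d α g (-t) = - gStar d α g t := by
  have h : GStar d α g = fun s => GStar d α g (-s) := by ext s; rw [GStar_neg]
  rw [gStar, gStar]
  conv_rhs => rw [h]
  rw [deriv_comp_neg, neg_neg]

theorem HypG.mul_gStar_le (hG : HypG d α g gm gp) (hd : 3 ≤ d)
    (hα : α ∈ Ioo (0 : ℝ) 1) {t : ℝ} (ht : 0 < t) :
    t * gStar d α g t ≤ (1 / gp - α / d)⁻¹ * GStar d α g t := by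
  have hp := hG.GStar_pos hd hα ht
  have h := hG.invGStar_le hd hα hp
  rw [hG.invGStar_GStar hd hα ht.le] at h
  rw [hG.gStar_eq hd hα ht, ← div_eq_mul_inv, div_le_iff₀ (hG.sobolevIntegrand_pos hp)]
  linarith

theorem HypG.GStar_le_mul (hG : HypG d α g gm gp) (hd : 3 ≤ d)
    (hα : α ∈ Ioo (0 : ℝ) 1) {t : ℝ} (ht : 0 < t) :
    GStar d α g t ≤ t * gStar d α g t := by
  have hp := hG.GStar_pos hd hα ht
  have h := hG.le_invGStar hd hα hp
  rw [hG.invGStar_GStar hd hα ht.le] at h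
  rwa [hG.gStar_eq hd hα ht, ← div_eq_mul_inv, le_div_iff₀ (hG.sobolevIntegrand_pos hp)]

/-- `G_*` satisfies the `Δ₂` condition. -/
theorem HypG.GStar_mul_le (hG : HypG d α g gm gp) (hd : 3 ≤ d)
    (hα : α ∈ Ioo (0 : ℝ) 1) {l t : ℝ} (hl : 1 ≤ l) (ht : 0 ≤ t) :
    GStar d α g (l * t) ≤ l ^ (1 / gp - α / d)⁻¹ * GStar d α g t := by
  rcases eq_or_lt_of_le ht with rfl | h
  · simp [hG.GStar_zero hd hα]
  · have hl0 : 0 < l := one_pos.trans_le hl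
    have := antitoneOn_div_rpow (fun s hs => hG.hasDerivAt_GStar hd hα hs)
      (fun s hs => hG.gStar_eq hd hα hs ▸ hG.mul_gStar_le hd hα hs) h
      (mul_pos hl0 h) (le_mul_of_one_le_left ht hl)
    simp only at this
    rw [Real.mul_rpow hl0.le ht, div_le_div_iff₀ (by positivity) (by positivity)] at this
    have h2 : 0 < t ^ (1 / gp - α / d)⁻¹ := Real.rpow_pos_of_pos h _
    nlinarith

/-- Convexity of `G_*`, in the form used to bound averages: for any `a > 0`,
`t ≤ a + (a / G_*(a)) G_*(t)`. -/
theorem HypG.le_add_GStar (hG : HypG d α g gm gp) (hd : 3 ≤ d)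
    (hα : α ∈ Ioo (0 : ℝ) 1) {a t : ℝ} (ha : 0 < a) :
    t ≤ a + a / GStar d α g a * GStar d α g t := by
  have hp := hG.GStar_pos hd hα ha
  have hnn := GStar_nonneg (d := d) (α := α) (g := g) t
  rcases le_total t a with h | h
  · have : 0 ≤ a / GStar d α g a * GStar d α g t := by positivity
    linarith
  · have h1 := monotoneOn_div_rpow (m := 1) (fun s hs => hG.hasDerivAt_GStar hd hα hs)
      (fun s hs => hG.gStar_eq hd hα hs ▸ (one_mul (GStar d α g s)).trans_le
        (hG.GStar_le_mul hd hα hs)) ha (ha.trans_le h) h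
    simp only [Real.rpow_one] at h1
    rw [div_le_div_iff₀ ha (ha.trans_le h)] at h1
    have : t ≤ a / GStar d α g a * GStar d α g t := by
      rw [div_mul_eq_mul_div, le_div_iff₀ hp]
      linarith
    linarith

/-- The analogue for `G`. -/
theorem HypG.le_add_bigG (hG : HypG d α g gm gp) {a t : ℝ} (ha : 0 < a) :
    t ≤ a + a / bigG g a * bigG g t := by
  have hp := hG.bigG_pos ha.ne'
  have hnn := hG.bigG_nonneg t
  rcases le_total t a with h | h
  · have : 0 ≤ a / bigG g a * bigG g t := by positivity
    linarith
  · have h1 := hG.le_bigG_mul (l := t / a) ((one_le_div ha).2 h) ha.le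
    rw [div_mul_cancel₀ _ ha.ne'] at h1
    have : t ≤ a / bigG g a * bigG g t := by
      calc t = a / bigG g a * (t / a * bigG g a) := by field_simp
        _ ≤ _ := by gcongr
    linarith

/-- `G_*(a) ≤ G(a G_*(a)^{α/d})`: the scaling relation between `G` and its conjugate. -/
theorem HypG.GStar_le_bigG (hG : HypG d α g gm gp) (hd : 3 ≤ d)
    (hα : α ∈ Ioo (0 : ℝ) 1) {a : ℝ} (ha : 0 < a) :
    GStar d α g a ≤ bigG g (a * GStar d α g a ^ (α / d)) := by
  have hp := hG.GStar_pos hd hα ha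
  have h := hG.le_invGStar hd hα hp
  rw [hG.invGStar_GStar hd hα ha.le, sobolevIntegrand_eq hd, Real.rpow_add hp, Real.rpow_one] at h
  have h4 : 0 < GStar d α g a ^ (α / d) := Real.rpow_pos_of_pos hp _
  have h5 : invG g (GStar d α g a) ≤ a * GStar d α g a ^ (α / d) := by
    rw [← div_le_iff₀ h4]
    refine le_trans (le_of_eq ?_) h
    field_simp
  conv_lhs => rw [← hG.bigG_invG hp.le]
  refine hG.bigG_le ?_
  rw [abs_of_pos (hG.invG_pos hp), abs_of_pos (by positivity)]
  exact h5

/-- On bounded sets `G_*` is dominated by `G`. -/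
theorem HypG.exists_GStar_le_bigG (hG : HypG d α g gm gp) (hd : 3 ≤ d)
    (hα : α ∈ Ioo (0 : ℝ) 1) (N : ℝ) :
    ∃ C, 0 ≤ C ∧ ∀ t, |t| ≤ N → GStar d α g t ≤ C * bigG g t := by
  set a := invGStar d α g 1 with ha
  have ha0 : 0 < a := (hG.homeo_invGStar hd hα).pos one_pos
  have hGa := hG.bigG_pos ha0.ne'
  refine ⟨max 1 (GStar d α g N / bigG g a), le_max_of_le_left zero_le_one, fun t ht => ?_⟩
  have hnn := hG.bigG_nonneg t
  rcases eq_or_ne t 0 with rfl | h0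
  · simp [hG.GStar_zero hd hα, bigG_zero]
  rcases le_total |t| a with h | h
  · refine le_trans ?_ (mul_le_mul_of_nonneg_right (le_max_left _ _) hnn)
    rw [one_mul, ← GStar_abs]
    have ht0 : 0 < |t| := abs_pos.2 h0
    refine (hG.GStar_le_bigG hd hα ht0).trans (hG.bigG_le ?_)
    have h1 : GStar d α g |t| ≤ 1 := by
      rw [← hG.GStar_invGStar hd hα one_pos, ← ha]
      refine hG.GStar_le hd hα ?_
      rw [abs_abs, abs_of_pos ha0]
      exact h
    have h2 : GStar d α g |t| ^ (α / d) ≤ 1 :=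
      Real.rpow_le_one (GStar_nonneg _) h1 (div_nonneg hα.1.le (Nat.cast_nonneg d))
    rw [abs_of_nonneg (mul_nonneg ht0.le (Real.rpow_nonneg (GStar_nonneg _) _))]
    exact mul_le_of_le_one_right ht0.le h2
  · refine le_trans ?_ (mul_le_mul_of_nonneg_right (le_max_right _ _) hnn)
    have h1 : GStar d α g t ≤ GStar d α g N := hG.GStar_le hd hα (ht.trans (le_abs_self N))
    have h2 : bigG g a ≤ bigG g t := hG.bigG_le (by rwa [abs_of_pos ha0])
    have h3 := GStar_nonneg (d := d) (α := α) (g := g) N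
    calc GStar d α g t ≤ GStar d α g N := h1
      _ = GStar d α g N / bigG g a * bigG g a := by field_simp
      _ ≤ _ := by gcongr

theorem HypG.GStar_add_le (hG : HypG d α g gm gp) (hd : 3 ≤ d)
    (hα : α ∈ Ioo (0 : ℝ) 1) (s t : ℝ) : GStar d α g (|s| + |t|) ≤
      2 ^ (1 / gp - α / d)⁻¹ * (GStar d α g s + GStar d α g t) := by
  have hm : 0 ≤ max |s| |t| := (abs_nonneg s).trans (le_max_left _ _)
  have h1 : GStar d α g (|s| + |t|) ≤ GStar d α g (2 * max |s| |t|) := by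
    refine hG.GStar_le hd hα ?_
    rw [abs_of_nonneg (show 0 ≤ |s| + |t| by positivity),
      abs_of_nonneg (show 0 ≤ 2 * max |s| |t| by positivity)]
    linarith [le_max_left |s| |t|, le_max_right |s| |t|]
  refine (h1.trans (hG.GStar_mul_le hd hα one_le_two hm)).trans ?_
  gcongr
  have := GStar_nonneg (d := d) (α := α) (g := g) s
  have := GStar_nonneg (d := d) (α := α) (g := g) t
  rcases max_choice |s| |t| with h | h <;> rw [h, GStar_abs] <;> linarith

end Conjugate

/-! ### The nonlinearity -/

section Nonlinearity

/-- At a point of differentiability the derivative belongs to Clarke's subdifferential. -/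
theorem smulRight_mem_genSubdiff {φ : ℝ → ℝ} (hφ : LocallyLipschitz φ) {s c : ℝ}
    (hs : HasDerivAt φ c s) : ContinuousLinearMap.toSpanSingleton ℝ c ∈ genSubdiff φ s := by
  intro v
  obtain ⟨K, U, hU, hK⟩ := hφ s
  have hmap : Tendsto (fun p : ℝ × ℝ => p.1 + p.2 • v) (𝓝 s ×ˢ 𝓝[>] (0 : ℝ)) (𝓝 s) := by
    have h1 : Tendsto (fun p : ℝ × ℝ => p.1 + p.2 • v) (𝓝 (s, 0)) (𝓝 (s + (0 : ℝ) • v)) :=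
      Continuous.tendsto (by fun_prop) _
    rw [zero_smul, add_zero, nhds_prod_eq] at h1
    exact h1.mono_left (prod_mono le_rfl nhdsWithin_le_nhds)
  -- near `s` the difference quotients are bounded by the Lipschitz constant
  have hbdd : ∀ᶠ p : ℝ × ℝ in 𝓝 s ×ˢ 𝓝[>] (0 : ℝ),
      |(φ (p.1 + p.2 • v) - φ p.1) / p.2| ≤ K * |v| := by
    filter_upwards [hmap.eventually hU, tendsto_fst.eventually hU,
      tendsto_snd.eventually (self_mem_nhdsWithin : Ioi (0 : ℝ) ∈ 𝓝[>] 0)] with p h1 h2 h3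
    have h4 : (0 : ℝ) < p.2 := h3
    have h5 := hK.dist_le_mul _ h1 _ h2
    rw [Real.dist_eq, Real.dist_eq, add_sub_cancel_left, smul_eq_mul, abs_mul,
      abs_of_pos h4] at h5
    rw [abs_div, abs_of_pos h4, div_le_iff₀ h4, smul_eq_mul]
    linarith
  have hup : (𝓝 s ×ˢ 𝓝[>] (0 : ℝ)).IsBoundedUnder (· ≤ ·)
      (fun p : ℝ × ℝ => (φ (p.1 + p.2 • v) - φ p.1) / p.2) :=
    ⟨K * |v|, eventually_map.2 (hbdd.mono fun p hp => (le_abs_self _).trans hp)⟩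
  refine le_of_forall_gt_imp_ge_of_dense fun b hb => ?_
  have hev := eventually_lt_of_limsup_lt (show limsup _ _ < b from hb) hup
  -- restrict to the slice of base points `s`, where the quotients tend to the derivative
  have hline : Tendsto (fun t : ℝ => (s, t)) (𝓝[>] 0) (𝓝 s ×ˢ 𝓝[>] (0 : ℝ)) :=
    tendsto_const_nhds.prodMk tendsto_id
  have h1 := hline.eventually hev
  have h2 : HasDerivAt (fun t : ℝ => φ (s + t • v)) (c * v) 0 := by
    have h3 : HasDerivAt (fun t : ℝ => s + t • v) v 0 := by
      simpa using ((hasDerivAt_id (0 : ℝ)).mul_const v).const_add s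
    refine HasDerivAt.comp (h₂ := φ) (0 : ℝ) ?_ h3
    simpa using hs
  have h3 : Tendsto _ (𝓝[>] (0 : ℝ)) _ :=
    h2.tendsto_slope.mono_left (nhdsWithin_mono _ fun t ht => ne_of_gt ht)
  have h4 : c * v ≤ b := le_of_tendsto h3 (h1.mono fun t ht => by
    rw [slope_def_field]
    simpa using ht.le)
  simpa [mul_comm] using h4

theorem lt_of_ae_deriv_pos {φ : ℝ → ℝ} {a b : ℝ} (hab : a < b)
    (hφ : AbsolutelyContinuousOnInterval φ a b)
    (h : ∀ᵐ x : ℝ, x ∈ Ioc a b → 0 < deriv φ x) : φ a < φ b := by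
  rw [← sub_pos, ← hφ.integral_deriv_eq_sub, intervalIntegral.integral_of_le hab.le]
  have hpos : ∀ᵐ x ∂(volume.restrict (Ioc a b)), 0 < deriv φ x :=
    (ae_restrict_iff' measurableSet_Ioc).2 h
  have hint := hφ.intervalIntegrable_deriv
  rw [intervalIntegrable_iff_integrableOn_Ioc_of_le hab.le] at hint
  rw [integral_pos_iff_support_of_nonneg_ae (hpos.mono fun x hx => hx.le) hint]
  have : Function.support (deriv φ) =ᵐ[volume.restrict (Ioc a b)] univ := by
    filter_upwards [hpos] with x hx
    exact eq_true hx.ne'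
  rw [measure_congr this, Measure.restrict_apply_univ, Real.volume_Ioc]
  simpa using hab

/-- A continuous function with the sign of its argument that grows strictly faster than the power
`p` along each of the two rays from the origin. -/
structure IsSuperpower (p : ℝ) (φ : ℝ → ℝ) : Prop where
  cont : Continuous φ
  zero : φ 0 = 0
  pos : ∀ s, s ≠ 0 → 0 < φ s * s
  ray : ∀ s, s ≠ 0 → ∀ t₁ t₂, 0 < t₁ → t₁ < t₂ → φ (t₁ * s) * s / t₁ ^ p < φ (t₂ * s) * s / t₂ ^ p

/-- The two growth properties on the positive half-line: a differential inequality valid wherever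
`φ` is differentiable integrates, since `φ` is absolutely continuous on compact intervals. -/
theorem superpower_on_Ioi {p : ℝ} {φ : ℝ → ℝ} (hφ : LocallyLipschitz φ) (h0 : φ 0 = 0)
    (h : ∀ s, s ≠ 0 → ∀ c, HasDerivAt φ c s → 0 < p * φ s * s ∧ p * φ s * s < c * s ^ 2) :
    (∀ s, 0 < s → 0 < φ s) ∧ ∀ a b, 0 < a → a < b → φ a / a ^ p < φ b / b ^ p := by
  have hAC : ∀ a b : ℝ, AbsolutelyContinuousOnInterval φ a b := fun a b => by
    obtain ⟨K, hK⟩ := (hφ.locallyLipschitzOn (s := uIcc a b)).exists_lipschitzOnWith_of_compact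
      isCompact_uIcc
    exact hK.absolutelyContinuousOnInterval
  constructor
  · intro s hs
    rw [← h0]
    refine lt_of_ae_deriv_pos hs (hAC 0 s) ?_
    filter_upwards [(hAC 0 s).ae_differentiableAt] with x hx hxs
    have hd := (hx (by rw [uIcc_of_le hs.le]; exact Ioc_subset_Icc_self hxs)).hasDerivAt
    obtain ⟨h1, h2⟩ := h x hxs.1.ne' _ hd
    exact pos_of_mul_pos_left (h1.trans h2) (sq_nonneg x)
  · intro a b ha hab
    have hne : ∀ x ∈ uIcc a b, 0 < x := fun x hx => by
      rw [uIcc_of_le hab.le] at hx; exact ha.trans_le hx.1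
    have hAC2 : AbsolutelyContinuousOnInterval (fun x : ℝ => x ^ (-p)) a b := by
      have : LocallyLipschitzOn (uIcc a b) (fun x : ℝ => x ^ (-p)) :=
        ContDiffOn.locallyLipschitzOn (convex_uIcc a b) fun x hx =>
          (Real.contDiffAt_rpow_const_of_ne (hne x hx).ne').contDiffWithinAt
      obtain ⟨K, hK⟩ := this.exists_lipschitzOnWith_of_compact isCompact_uIcc
      exact hK.absolutelyContinuousOnInterval
    have key := lt_of_ae_deriv_pos hab ((hAC a b).fun_mul hAC2) (by
      filter_upwards [(hAC a b).ae_differentiableAt] with x hx hxs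
      have hx' : x ∈ uIcc a b := by rw [uIcc_of_le hab.le]; exact Ioc_subset_Icc_self hxs
      have hx0 := hne x hx'
      have hd := (hx hx').hasDerivAt
      rw [(hd.fun_mul (Real.hasDerivAt_rpow_const (p := -p) (Or.inl hx0.ne'))).deriv]
      obtain ⟨-, h2⟩ := h x hx0.ne' _ hd
      have e : x ^ (-p) = x ^ (-p - 1) * x := by
        rw [Real.rpow_sub_one hx0.ne']; field_simp
      have h3 : 0 < x ^ (-p - 1) := Real.rpow_pos_of_pos hx0 _
      rw [e]
      have h4 : 0 < deriv φ x * x - p * φ x := by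
        refine pos_of_mul_pos_left (b := x) ?_ hx0.le
        linarith
      have h5 := mul_pos h3 h4
      linarith)
    simpa only [Real.rpow_neg ha.le, Real.rpow_neg (ha.trans hab).le, ← div_eq_mul_inv] using key

theorem isSuperpower_of_genSubdiff {p : ℝ} {φ : ℝ → ℝ} (hφ : LocallyLipschitz φ)
    (h0 : φ 0 = 0) (h : ∀ s, 0 < |s| → ∀ ξ ∈ genSubdiff φ s,
      0 < p * φ s * s ∧ p * φ s * s < ξ 1 * s ^ 2) : IsSuperpower p φ := by
  have h' : ∀ s, s ≠ 0 → ∀ c, HasDerivAt φ c s → 0 < p * φ s * s ∧ p * φ s * s < c * s ^ 2 :=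
    fun s hs c hc => by
      simpa using h s (abs_pos.2 hs) _ (smulRight_mem_genSubdiff hφ hc)
  obtain ⟨hpos, hray⟩ := superpower_on_Ioi hφ h0 h'
  -- the negative ray is the positive ray of the reflected function
  have hneg : LocallyLipschitz fun s => - φ (-s) :=
    LocallyLipschitz.neg (hφ.comp LocallyLipschitz.id.neg)
  obtain ⟨hpos', hray'⟩ := superpower_on_Ioi (φ := fun s => - φ (-s)) hneg (by simp [h0])
    fun s hs c hc => by
      have h1 : HasDerivAt φ c (-s) := by
        have h2 : HasDerivAt (fun s => - φ (-s)) c (- -s) := by rwa [neg_neg]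
        have := (h2.comp (-s) (hasDerivAt_neg (-s))).fun_neg
        simpa [Function.comp_def] using this
      have := h' (-s) (neg_ne_zero.2 hs) c h1
      simp only [even_two, Even.neg_pow] at this
      constructor <;> linarith
  refine ⟨hφ.continuous, h0, fun s hs => ?_, fun s hs t₁ t₂ h1 h12 => ?_⟩
  · rcases lt_or_gt_of_ne hs with h1 | h1
    · have := hpos' (-s) (neg_pos.2 h1)
      rw [neg_neg] at this
      nlinarith
    · exact mul_pos (hpos s h1) h1
  · have h2 := h1.trans h12
    have p1 : 0 < t₁ ^ p := Real.rpow_pos_of_pos h1 _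
    have p2 : 0 < t₂ ^ p := Real.rpow_pos_of_pos h2 _
    rcases lt_or_gt_of_ne hs with hs' | hs'
    · have hs0 : 0 < -s := neg_pos.2 hs'
      have := hray' (t₁ * -s) (t₂ * -s) (by positivity) (by gcongr)
      rw [Real.mul_rpow h1.le hs0.le, Real.mul_rpow h2.le hs0.le] at this
      simp only [mul_neg, neg_neg] at this
      have p3 : 0 < (-s) ^ p := Real.rpow_pos_of_pos hs0 _
      rw [← div_div, ← div_div, div_lt_div_iff_of_pos_right p3] at this
      have h6 := mul_lt_mul_of_pos_right this hs0
      calc _ = -φ (t₁ * s) / t₁ ^ p * -s := by ring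
        _ < _ := h6
        _ = _ := by ring
    · have := hray (t₁ * s) (t₂ * s) (by positivity) (by gcongr)
      rw [Real.mul_rpow h1.le hs'.le, Real.mul_rpow h2.le hs'.le] at this
      have p3 : 0 < s ^ p := Real.rpow_pos_of_pos hs' _
      rw [← div_div, ← div_div, div_lt_div_iff_of_pos_right p3] at this
      have h6 := mul_lt_mul_of_pos_right this hs'
      calc _ = φ (t₁ * s) / t₁ ^ p * s := by ring
        _ < _ := h6
        _ = _ := by ring

variable {p : ℝ} {φ : ℝ → ℝ}

theorem IsSuperpower.nonneg (h : IsSuperpower p φ) (s : ℝ) : 0 ≤ φ s * s := by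
  rcases eq_or_ne s 0 with rfl | hs
  · simp
  · exact (h.pos s hs).le

theorem IsSuperpower.ray_le (h : IsSuperpower p φ) (s : ℝ) {t₁ t₂ : ℝ} (h1 : 0 < t₁)
    (h12 : t₁ ≤ t₂) : φ (t₁ * s) * s / t₁ ^ p ≤ φ (t₂ * s) * s / t₂ ^ p := by
  rcases eq_or_ne s 0 with rfl | hs
  · simp
  rcases eq_or_lt_of_le h12 with rfl | h12
  · exact le_rfl
  · exact (h.ray s hs _ _ h1 h12).le

/-- `φ(ts)s ≤ t^p φ(s)s` for `0 ≤ t ≤ 1`. -/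
theorem IsSuperpower.mul_le (h : IsSuperpower p φ) (hp : 0 < p) (s : ℝ) {t : ℝ} (h0 : 0 ≤ t)
    (h1 : t ≤ 1) : φ (t * s) * s ≤ t ^ p * (φ s * s) := by
  rcases eq_or_lt_of_le h0 with rfl | h0
  · simp [h.zero, Real.zero_rpow hp.ne']
  · have := h.ray_le s h0 h1
    rw [Real.one_rpow, div_one, one_mul, div_le_iff₀ (Real.rpow_pos_of_pos h0 _)] at this
    linarith

theorem IsSuperpower.mul_le_self (h : IsSuperpower p φ) (hp : 0 < p) (s : ℝ) {t : ℝ} (h0 : 0 ≤ t)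
    (h1 : t ≤ 1) : φ (t * s) * s ≤ φ s * s :=
  (h.mul_le hp s h0 h1).trans
    (mul_le_of_le_one_left (h.nonneg s) (Real.rpow_le_one h0 h1 hp.le))

theorem IsSuperpower.nonneg_and_le (h : IsSuperpower p φ) (hp : 0 < p) {s m : ℝ} (hs : 0 ≤ s)
    (hm : s ≤ m) : 0 ≤ φ s ∧ φ s ≤ φ m := by
  rcases eq_or_lt_of_le hs with rfl | hs
  · rw [h.zero]
    refine ⟨le_rfl, ?_⟩
    rcases eq_or_lt_of_le hm with rfl | hm
    · rw [h.zero]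
    · exact (pos_of_mul_pos_left (h.pos m hm.ne') hm.le).le
  · have hm0 := hs.trans_le hm
    refine ⟨(pos_of_mul_pos_left (h.pos s hs.ne') hs.le).le, ?_⟩
    have := h.mul_le_self hp m (t := s / m) (by positivity) (by rwa [div_le_one hm0])
    rw [div_mul_cancel₀ _ hm0.ne'] at this
    exact le_of_mul_le_mul_right this hm0

theorem IsSuperpower.reflect (h : IsSuperpower p φ) : IsSuperpower p fun s => - φ (-s) where
  cont := (h.cont.comp continuous_neg).neg
  zero := by simp [h.zero]
  pos s hs := by have := h.pos (-s) (neg_ne_zero.2 hs); linarith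
  ray s hs t₁ t₂ h1 h12 := by
    have := h.ray (-s) (neg_ne_zero.2 hs) t₁ t₂ h1 h12
    simpa only [mul_neg, neg_mul] using this

/-- On `[-m, m]` the function is bounded by its values at the end points. -/
theorem IsSuperpower.abs_le (h : IsSuperpower p φ) (hp : 0 < p) {s m : ℝ} (hm : |s| ≤ m) :
    |φ s| ≤ |φ m| + |φ (-m)| := by
  have h1 := abs_nonneg (φ m)
  have h2 := abs_nonneg (φ (-m))
  rcases le_total 0 s with hs | hs
  · rw [abs_of_nonneg hs] at hm
    obtain ⟨a, b⟩ := h.nonneg_and_le hp hs hm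
    rw [abs_of_nonneg a]
    linarith [le_abs_self (φ m)]
  · rw [abs_of_nonpos hs] at hm
    obtain ⟨a, b⟩ := h.reflect.nonneg_and_le hp (neg_nonneg.2 hs) hm
    simp only [neg_neg] at a b
    rw [abs_of_nonpos (by linarith)]
    linarith [neg_abs_le (φ (-m))]

theorem integral_eq_ray (φ : ℝ → ℝ) (s : ℝ) :
    ∫ t in (0 : ℝ)..s, φ t = ∫ t in (0 : ℝ)..1, φ (t * s) * s := by
  have := intervalIntegral.mul_integral_comp_mul_left (f := φ) (a := 0) (b := 1) s
  rw [mul_zero, mul_one] at this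
  rw [← this, ← intervalIntegral.integral_const_mul]
  congr 1
  ext t
  rw [mul_comm s t, mul_comm]

/-- The primitive satisfies the Ambrosetti–Rabinowitz type inequality
`(p + 1) ∫₀ˢ φ ≤ s φ(s)`. -/
theorem IsSuperpower.integral_le (h : IsSuperpower p φ) (hp : 0 < p) (s : ℝ) :
    0 ≤ ∫ t in (0 : ℝ)..s, φ t ∧ (p + 1) * ∫ t in (0 : ℝ)..s, φ t ≤ φ s * s := by
  rw [integral_eq_ray]
  have hc := h.cont
  constructor
  · refine intervalIntegral.integral_nonneg zero_le_one fun t ht => ?_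
    rcases eq_or_lt_of_le ht.1 with rfl | h0
    · simp [h.zero]
    · refine nonneg_of_mul_nonneg_right (a := t) ?_ h0
      linarith [h.nonneg (t * s)]
  · have := intervalIntegral.integral_mono_on (μ := volume) (a := 0) (b := 1)
      (f := fun t => φ (t * s) * s) (g := fun t => t ^ p * (φ s * s)) zero_le_one
      (Continuous.intervalIntegrable (by fun_prop) _ _)
      ((intervalIntegral.intervalIntegrable_rpow' (by linarith)).mul_const _)
      (fun t ht => h.mul_le hp s ht.1 ht.2)
    have e : ∫ t in (0 : ℝ)..1, t ^ p * (φ s * s) = 1 / (p + 1) * (φ s * s) := by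
      rw [intervalIntegral.integral_mul_const, integral_rpow (Or.inl (by linarith)),
        Real.zero_rpow (by positivity), Real.one_rpow, sub_zero]
    rw [e] at this
    calc _ ≤ (p + 1) * (1 / (p + 1) * (φ s * s)) := by gcongr
      _ = _ := by field_simp

end Nonlinearity

section
variable {d : ℕ} {α : ℝ} {g : ℝ → ℝ} {gm gp : ℝ} {f : E d → ℝ → ℝ}

theorem HypF.isSuperpower (hf : HypF d α g gp f) :
    ∀ᵐ x : E d, IsSuperpower (gp - 1) (f x) := by
  filter_upwards [hf.zero, hf.lip, hf.subdiff] with x h0 h1 h2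
  exact isSuperpower_of_genSubdiff h1 h0 h2

/-- Subcritical growth: `|f(x,s)s| ≤ C (G(s) + G_*(s))`, uniformly in `x`. -/
theorem HypF.exists_growth (hG : HypG d α g gm gp) (hd : 3 ≤ d) (hα : α ∈ Ioo (0 : ℝ) 1)
    (hf : HypF d α g gp f) : ∃ C, 0 ≤ C ∧ ∀ᵐ x : E d, ∀ s : ℝ,
      |f x s| * |s| ≤ C * (bigG g s + GStar d α g s) := by
  have hp : 0 < gp - 1 := by linarith [hG.gp_mem.1]
  obtain ⟨δ, hδ, h1⟩ := hf.at_zero 1 one_pos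
  obtain ⟨R, hR, h2⟩ := hf.at_top 1 one_pos
  have hsub : 0 < (1 / gp - α / d)⁻¹ := inv_pos.2 (by linarith [hG.subcritical hα])
  -- `m` lies in the range controlled by `g_*`; between `δ` and `m` monotonicity of `f(x, ·)` bounds
  -- it by its values at `±m`, uniformly in `x`
  set m := max (R + 1) δ with hm
  have hm0 : 0 < m := lt_max_of_lt_right hδ
  have habs : ∀ s, s ≠ 0 → |gStar d α g s| = gStar d α g |s| := fun s hs => by
    rcases abs_choice s with h | h
    · rw [h, abs_of_pos]
      rw [← h]; exact hG.gStar_pos hd hα (abs_pos.2 hs)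
    · rw [h, gStar_neg, abs_of_neg]
      rw [← neg_pos, ← gStar_neg, ← h]; exact hG.gStar_pos hd hα (abs_pos.2 hs)
  have hgδ := hG.pos δ hδ
  have hgm := hG.gStar_pos hd hα hm0
  refine ⟨gp + gp * (2 * gStar d α g m / g δ) + (1 / gp - α / d)⁻¹,
    by have := hG.gp_pos; positivity, ?_⟩
  filter_upwards [h1, h2, hf.isSuperpower] with x hx1 hx2 hx
  intro s
  have hG0 := hG.bigG_nonneg s
  have hG1 := GStar_nonneg (d := d) (α := α) (g := g) s
  have hgp := hG.gp_pos
  rcases eq_or_ne s 0 with rfl | hs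
  · simp [bigG_zero, hG.GStar_zero hd hα]
  have hs0 := abs_pos.2 hs
  have hgs : |s| * g |s| ≤ gp * bigG g s := by
    rw [← hG.bigG_abs]; exact hG.mul_g_le hs0.le
  have hgS : |s| * gStar d α g |s| ≤ (1 / gp - α / d)⁻¹ * GStar d α g s := by
    rw [← GStar_abs]; exact hG.mul_gStar_le hd hα hs0
  have big : ∀ r, R < |r| → |f x r| ≤ gStar d α g |r| := fun r hr => by
    have hr0 : r ≠ 0 := abs_pos.1 (hR.trans hr)
    have := hx2 r hr
    rw [abs_div, habs r hr0, div_lt_one (hG.gStar_pos hd hα (abs_pos.2 hr0))] at this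
    exact this.le
  have t1 : 0 ≤ gp * bigG g s := by positivity
  have t2 : 0 ≤ gp * (2 * gStar d α g m / g δ) * bigG g s := by positivity
  have t3 : 0 ≤ (1 / gp - α / d)⁻¹ * GStar d α g s := by positivity
  have t4 : 0 ≤ (gp + gp * (2 * gStar d α g m / g δ)) * GStar d α g s := by positivity
  have t5 : 0 ≤ (1 / gp - α / d)⁻¹ * bigG g s := by positivity
  rcases lt_or_ge |s| δ with h | h
  · have h3 := hx1 s hs0 h
    have h4 : |g s| = g |s| := by
      rcases abs_choice s with h | h <;> rw [h]
      · rw [abs_of_pos]; rw [← h]; exact hG.pos _ hs0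
      · rw [hG.odd, abs_of_neg]; rw [← neg_pos, ← hG.odd, ← h]; exact hG.pos _ hs0
    rw [abs_div, h4, div_lt_one (hG.pos _ hs0)] at h3
    have h5 : |f x s| * |s| ≤ g |s| * |s| := by gcongr
    linarith
  rcases le_or_gt |s| m with h' | h'
  · have h6 := hx.abs_le hp h'
    have hRm : R < |m| := by rw [abs_of_pos hm0]; exact lt_max_of_lt_left (by linarith)
    have h7 := big m hRm
    have h8 := big (-m) (by rwa [abs_neg])
    rw [abs_of_pos hm0] at h7
    rw [abs_neg, abs_of_pos hm0] at h8
    have h9 : g δ ≤ g |s| := hG.mono h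
    have h10 : |f x s| * |s| ≤ 2 * gStar d α g m / g δ * (|s| * g |s|) := by
      calc |f x s| * |s| ≤ (2 * gStar d α g m) * |s| := by gcongr; linarith
        _ = 2 * gStar d α g m / g δ * (|s| * g δ) := by field_simp
        _ ≤ _ := by gcongr
    have h11 : 2 * gStar d α g m / g δ * (|s| * g |s|) ≤
        2 * gStar d α g m / g δ * (gp * bigG g s) := by gcongr
    linarith
  · have h6 := big s (lt_of_lt_of_le (by linarith) ((le_max_left _ _).trans h'.le))
    have h5 : |f x s| * |s| ≤ gStar d α g |s| * |s| := by gcongr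
    linarith

/-- The domination used when differentiating the term with `F`. -/
theorem HypF.exists_dom (hG : HypG d α g gm gp) (hd : 3 ≤ d) (hα : α ∈ Ioo (0 : ℝ) 1)
    (hf : HypF d α g gp f) : ∃ C, 0 ≤ C ∧ ∀ᵐ x : E d, ∀ a b s : ℝ, |s| ≤ 1 →
      |f x (a + s * b) * b| ≤
        C * ((bigG g a + bigG g b) + (GStar d α g a + GStar d α g b)) := by
  obtain ⟨C, hC, h⟩ := hf.exists_growth hG hd hα
  have hp : 0 < gp - 1 := by linarith [hG.gp_mem.1]
  set c1 : ℝ := 2 ^ gp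
  set c2 : ℝ := 2 ^ (1 / gp - α / d)⁻¹
  refine ⟨2 * C * (c1 + c2), by positivity, ?_⟩
  filter_upwards [h, hf.isSuperpower] with x hx hs
  intro a b s hs1
  set m := |a| + |b| with hm
  have hm0 : 0 ≤ m := by positivity
  have h1 : |a + s * b| ≤ m := (abs_add_le _ _).trans (by
    rw [abs_mul, hm]; gcongr; exact mul_le_of_le_one_left (abs_nonneg b) hs1)
  have h2 := hs.abs_le hp h1
  have h3 := hx m
  have h4 := hx (-m)
  rw [hG.bigG_neg, GStar_neg, abs_neg, abs_of_nonneg hm0] at h4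
  rw [abs_of_nonneg hm0] at h3
  have h5 := hG.bigG_add_le a b
  have h6 := hG.GStar_add_le hd hα a b
  have n1 := hG.bigG_nonneg a
  have n2 := hG.bigG_nonneg b
  have n3 := GStar_nonneg (d := d) (α := α) (g := g) a
  have n4 := GStar_nonneg (d := d) (α := α) (g := g) b
  have hbm : |b| ≤ m := by linarith [abs_nonneg a]
  rw [abs_mul]
  calc |f x (a + s * b)| * |b| ≤ (|f x m| + |f x (-m)|) * m := by gcongr
    _ ≤ 2 * C * (bigG g m + GStar d α g m) := by linarith
    _ ≤ 2 * C * (c1 * (bigG g a + bigG g b) + c2 * (GStar d α g a + GStar d α g b)) := by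
      gcongr
    _ ≤ 2 * C * ((c1 + c2) * ((bigG g a + bigG g b) + (GStar d α g a + GStar d α g b))) := by
      gcongr
      have : 0 < c1 := by positivity
      have : 0 < c2 := by positivity
      nlinarith [mul_nonneg this.le (add_nonneg n1 n2), mul_nonneg ‹0 < c1›.le (add_nonneg n3 n4)]
    _ = _ := by ring

end

/-! ### The embedding of `W^{α,G}` into the Orlicz class of `G_*` -/

section Embedding
variable {d : ℕ} {α : ℝ} {g : ℝ → ℝ} {gm gp : ℝ}

/-- The local energy `∫ G((u(x)-u(y))/|x-y|^α) dy / |x-y|^d` of `u` at `x`. -/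
def localEnergy (α : ℝ) (g : ℝ → ℝ) (u : E d → ℝ) (x : E d) : ENNReal :=
  ∫⁻ y, ENNReal.ofReal (bigG g (fracQuot α u (x, y)) / ‖x - y‖ ^ d)

/-- The volume of the unit ball of `ℝ^d`. -/
def unitVol (d : ℕ) : ℝ := (volume (Metric.ball (0 : E d) 1)).toReal

theorem unitVol_pos : 0 < unitVol d :=
  ENNReal.toReal_pos (Metric.measure_ball_pos _ _ one_pos).ne' measure_ball_lt_top.ne

theorem volume_ball_eq (x : E d) {r : ℝ} (hr : 0 < r) :
    volume (Metric.ball x r) = ENNReal.ofReal (unitVol d * r ^ d) := by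
  rw [Measure.addHaar_ball_of_pos _ _ hr, finrank_euclideanSpace_fin, mul_comm,
    ENNReal.ofReal_mul unitVol_pos.le, unitVol, ENNReal.ofReal_toReal measure_ball_lt_top.ne]

/-- The pointwise estimate behind the embedding: if `∫ G_*(w) ≤ M`, comparing `w(x)` with the
average of `w` over the ball of volume `M / G_*(w(x)/8)` bounds `G_*(w(x)/8)` by the local
energy at `x`. -/
theorem HypG.GStar_le_localEnergy (hG : HypG d α g gm gp) (hd : 3 ≤ d) (hα : α ∈ Ioo (0 : ℝ) 1)
    {u w : E d → ℝ} (hw : AEMeasurable w) (hw0 : ∀ x, 0 ≤ w x)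
    (huw : ∀ x y, w x ≤ w y + |u x - u y|) {M : ℝ} (hM : unitVol d ≤ M)
    (hI : ∫⁻ y, ENNReal.ofReal (GStar d α g (w y)) ≤ ENNReal.ofReal M) (x : E d) :
    ENNReal.ofReal (5 * unitVol d * (unitVol d / M) ^ (α / d * gp) * GStar d α g (w x / 8)) ≤
      localEnergy α g u x := by
  have hω := unitVol_pos (d := d)
  have hM0 := hω.trans_le hM
  rcases eq_or_lt_of_le (hw0 x) with h0 | h0
  · simp [← h0, hG.GStar_zero hd hα]
  set a := w x / 8 with ha
  have ha0 : 0 < a := by positivity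
  have hS := hG.GStar_pos hd hα ha0
  have hd0 : (d : ℝ) ≠ 0 := by positivity
  set ω := unitVol d
  set S := GStar d α g a
  -- the ball of radius `r` has volume `M / S`, so `G_*(w)` has mean at most `S` there
  set r : ℝ := (M / (ω * S)) ^ (1 / d : ℝ) with hr
  have hr0 : 0 < r := by positivity
  have hrd : r ^ d = M / (ω * S) := by
    rw [hr, ← Real.rpow_natCast, ← Real.rpow_mul (by positivity), one_div_mul_cancel hd0,
      Real.rpow_one]
  have hrd0 : 0 < r ^ d := by positivity
  have hra : 0 < r ^ α := Real.rpow_pos_of_pos hr0 _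
  set b := a / r ^ α with hb
  have hb0 : 0 < b := by positivity
  have hab : r ^ α * b = a := by rw [hb]; field_simp
  have hGb := hG.bigG_pos hb0.ne'
  -- the scaling relation bounds `S` by `G(b)` up to a power of `M`
  have hGbS : (ω / M) ^ (α / d * gp) * S ≤ bigG g b := by
    have h1 : (r ^ α)⁻¹ = (ω / M) ^ (α / d) * S ^ (α / d) := by
      rw [hr, ← Real.rpow_mul (by positivity), ← Real.inv_rpow (by positivity),
        ← Real.mul_rpow (by positivity) hS.le]
      congr 1
      · field_simp
      · ring
    set l := (ω / M) ^ (α / d) with hl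
    have hl0 : 0 < l := by positivity
    have hl1 : l ≤ 1 := Real.rpow_le_one (by positivity) ((div_le_one hM0).2 hM)
      (div_nonneg hα.1.le (Nat.cast_nonneg d))
    have h2 : b = l * (a * S ^ (α / d)) := by rw [hb, div_eq_mul_inv, h1]; ring
    have h3 := hG.bigG_mul_le (l := l⁻¹) (t := b) ((one_le_inv₀ hl0).2 hl1) hb0.le
    have h4 : l⁻¹ * b = a * S ^ (α / d) := by rw [h2]; field_simp
    rw [h4, Real.inv_rpow hl0.le, hl, ← Real.rpow_mul (by positivity)] at h3
    have h5 := (hG.GStar_le_bigG hd hα ha0).trans h3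
    rwa [← div_eq_inv_mul, le_div_iff₀' (by positivity)] at h5
  set h : E d → ℝ := fun y => bigG g (fracQuot α u (x, y)) / ‖x - y‖ ^ d with hh
  have hh0 : ∀ y, 0 ≤ h y := fun y => div_nonneg (hG.bigG_nonneg _) (by positivity)
  -- `8a = w(x) ≤ w(y) + |u(x) - u(y)|`, where each summand contributes one `a` plus a modular term
  have key : ∀ y ∈ Metric.ball x r,
      6 * a ≤ a / S * GStar d α g (w y) + a * r ^ d / bigG g b * h y := by
    intro y hy
    rw [Metric.mem_ball, dist_comm, dist_eq_norm] at hy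
    have e1 : |u x - u y| = ‖x - y‖ ^ α * |fracQuot α u (x, y)| := by
      rcases eq_or_ne x y with rfl | hne
      · simp [fracQuot]
      · have : 0 < ‖x - y‖ ^ α := Real.rpow_pos_of_pos (norm_pos_iff.2 (sub_ne_zero.2 hne)) _
        rw [fracQuot, abs_div, abs_of_pos this]
        field_simp
    have e2 : bigG g (fracQuot α u (x, y)) ≤ r ^ d * h y := by
      rcases eq_or_ne x y with rfl | hne
      · simp [fracQuot, bigG_zero, hh]
      · have : 0 < ‖x - y‖ := norm_pos_iff.2 (sub_ne_zero.2 hne)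
        simp only [hh]
        rw [← mul_div_assoc, le_div_iff₀ (by positivity), mul_comm]
        gcongr
        exact hG.bigG_nonneg _
    have e3 := hG.le_add_GStar hd hα (t := w y) ha0
    have e4 := hG.le_add_bigG (t := |fracQuot α u (x, y)|) hb0
    rw [hG.bigG_abs] at e4
    have e5 : |u x - u y| ≤ r ^ α * (b + b / bigG g b * (r ^ d * h y)) := by
      rw [e1]
      gcongr
      · exact hα.1.le
      · exact e4.trans (by gcongr)
    have e6 : r ^ α * (b + b / bigG g b * (r ^ d * h y)) = a + a * r ^ d / bigG g b * h y := by
      rw [← hab]; ring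
    have e7 := huw x y
    have e8 : w x = 8 * a := by rw [ha]; ring
    linarith
  have hint : ENNReal.ofReal (6 * a) * ENNReal.ofReal (ω * r ^ d) ≤
      ENNReal.ofReal (a / S) * ENNReal.ofReal M +
        ENNReal.ofReal (a * r ^ d / bigG g b) * localEnergy α g u x := by
    have hmeas : AEMeasurable (fun y => ENNReal.ofReal (GStar d α g (w y))) :=
      ((hG.continuous_GStar hd hα).measurable.comp_aemeasurable hw).ennreal_ofReal
    calc _ = ∫⁻ _ in Metric.ball x r, ENNReal.ofReal (6 * a) := by
          rw [setLIntegral_const, volume_ball_eq x hr0]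
      _ ≤ ∫⁻ y in Metric.ball x r, (ENNReal.ofReal (a / S) * ENNReal.ofReal (GStar d α g (w y)) +
            ENNReal.ofReal (a * r ^ d / bigG g b) * ENNReal.ofReal (h y)) := by
          refine setLIntegral_mono' Metric.isOpen_ball.measurableSet fun y hy => ?_
          rw [← ENNReal.ofReal_mul (by positivity), ← ENNReal.ofReal_mul (by positivity),
            ← ENNReal.ofReal_add (mul_nonneg (by positivity) (GStar_nonneg _))
              (mul_nonneg (by positivity) (hh0 y))]
          exact ENNReal.ofReal_le_ofReal (key y hy)
      _ ≤ ∫⁻ y, (ENNReal.ofReal (a / S) * ENNReal.ofReal (GStar d α g (w y)) +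
            ENNReal.ofReal (a * r ^ d / bigG g b) * ENNReal.ofReal (h y)) :=
          setLIntegral_le_lintegral _ _
      _ = ENNReal.ofReal (a / S) * (∫⁻ y, ENNReal.ofReal (GStar d α g (w y))) +
            ENNReal.ofReal (a * r ^ d / bigG g b) * localEnergy α g u x := by
          rw [lintegral_add_left' (hmeas.const_mul _), lintegral_const_mul'' _ hmeas,
            lintegral_const_mul' _ _ ENNReal.ofReal_ne_top]
          rfl
      _ ≤ _ := by gcongr
  rcases eq_or_ne (localEnergy α g u x) ⊤ with htop | htop
  · rw [htop]; exact le_top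
  rw [ENNReal.ofReal_le_iff_le_toReal htop]
  rw [← ENNReal.ofReal_toReal htop, ← ENNReal.ofReal_mul (by positivity),
    ← ENNReal.ofReal_mul (by positivity), ← ENNReal.ofReal_mul (by positivity),
    ← ENNReal.ofReal_add (by positivity) (by positivity),
    ENNReal.ofReal_le_ofReal_iff (by positivity)] at hint
  set δ := (localEnergy α g u x).toReal
  have h1 : a / S * M = a * (ω * r ^ d) := by rw [hrd]; field_simp
  rw [h1] at hint
  have h2 : 5 * ω * bigG g b ≤ δ := by
    have h3 : a * r ^ d * (5 * ω) ≤ a * r ^ d * (δ / bigG g b) := by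
      calc _ ≤ a * r ^ d / bigG g b * δ := by linarith
        _ = _ := by ring
    have h4 := le_of_mul_le_mul_left h3 (by positivity)
    rwa [le_div_iff₀ hGb] at h4
  refine le_trans ?_ h2
  calc _ = 5 * ω * ((ω / M) ^ (α / d * gp) * S) := by ring
    _ ≤ _ := by gcongr

theorem HypG.measurable_bigG (hG : HypG d α g gm gp) : Measurable (bigG g) :=
  hG.continuous_bigG.measurable

/-- Sobolev embedding in modular form: `∫ G_*(u) < ∞` for `u ∈ W^{α,G}`. The truncations of `u`
have finite `G_*`-modular, and integrating the pointwise estimate bounds it independently of the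
truncation level because `α g⁺ < d`. -/
theorem HypG.integrable_GStar (hG : HypG d α g gm gp) (hd : 3 ≤ d) (hα : α ∈ Ioo (0 : ℝ) 1)
    {u : E d → ℝ} (hu : u ∈ W d α g) : Integrable (fun x => GStar d α g (u x)) := by
  obtain ⟨hum, huG, huE⟩ := hu
  have hω := unitVol_pos (d := d)
  set ω := unitVol d with hωd
  have hgp := hG.gp_pos
  have hθ1 : α / d * gp < 1 := by
    have := hG.subcritical hα
    rwa [lt_div_iff₀ hgp] at this
  set θ := α / d * gp with hθ
  set κ := (1 / gp - α / d)⁻¹ with hκ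
  have hint : ∫⁻ x, localEnergy α g u x = ENNReal.ofReal
      (∫ p : E d × E d, bigG g (fracQuot α u p) / ‖p.1 - p.2‖ ^ d ∂(volume.prod volume)) := by
    rw [ofReal_integral_eq_lintegral_ofReal huE
      (Eventually.of_forall fun p => div_nonneg (hG.bigG_nonneg _) (by positivity)),
      lintegral_prod _ huE.aestronglyMeasurable.aemeasurable.ennreal_ofReal]
    rfl
  set T : ℝ := ∫ p : E d × E d, bigG g (fracQuot α u p) / ‖p.1 - p.2‖ ^ d ∂(volume.prod volume)
  have hT0 : 0 ≤ T := integral_nonneg fun p => div_nonneg (hG.bigG_nonneg _) (by positivity)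
  set c : ℝ := 5 * ω * ω ^ θ / 8 ^ κ with hc
  have hc0 : 0 < c := by positivity
  set B : ℝ := max ω ((T / c) ^ (1 / (1 - θ))) with hB
  have hcont := hG.continuous_GStar hd hα
  have bound : ∀ N : ℕ, ∫⁻ x, ENNReal.ofReal (GStar d α g (min |u x| N)) ≤ ENNReal.ofReal B := by
    intro N
    set w : E d → ℝ := fun x => min |u x| N with hw
    have hw0 : ∀ x, 0 ≤ w x := fun x => le_min (abs_nonneg _) (Nat.cast_nonneg N)
    have hwm : AEMeasurable w := hum.abs.min aemeasurable_const
    have hmeas : AEMeasurable (fun y => ENNReal.ofReal (GStar d α g (w y))) :=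
      (hcont.measurable.comp_aemeasurable hwm).ennreal_ofReal
    have huw : ∀ x y, w x ≤ w y + |u x - u y| := fun x y => by
      have h1 := abs_sub_abs_le_abs_sub (u x) (u y)
      have h2 := abs_nonneg (u x - u y)
      simp only [hw]
      rcases min_cases |u x| (N : ℝ) with ⟨h3, h4⟩ | ⟨h3, h4⟩ <;>
      rcases min_cases |u y| (N : ℝ) with ⟨h5, h6⟩ | ⟨h5, h6⟩ <;> rw [h3, h5] <;> linarith
    have hfin : ∫⁻ x, ENNReal.ofReal (GStar d α g (w x)) ≠ ⊤ := by
      obtain ⟨C, hC, h⟩ := hG.exists_GStar_le_bigG hd hα N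
      refine ((huG.const_mul C).mono' (hcont.measurable.comp_aemeasurable
        hwm).aestronglyMeasurable (Eventually.of_forall fun x => ?_)).lintegral_lt_top.ne
      have h1 : |w x| ≤ N := by rw [abs_of_nonneg (hw0 x)]; exact min_le_right _ _
      rw [Function.comp_apply, Real.norm_of_nonneg (GStar_nonneg _)]
      refine (h _ h1).trans ?_
      gcongr
      refine hG.bigG_le ?_
      rw [abs_of_nonneg (hw0 x)]
      exact min_le_left _ _
    rw [← ENNReal.ofReal_toReal hfin]
    refine ENNReal.ofReal_le_ofReal ?_
    set i := (∫⁻ x, ENNReal.ofReal (GStar d α g (w x))).toReal with hi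
    -- the pointwise estimate needs `M ≥ ω`; otherwise the modular is already bounded by `ω`
    rcases le_or_gt i ω with hiω | hiω
    · exact hiω.trans (le_max_left _ _)
    refine le_trans ?_ (le_max_right _ _)
    have hi0 := hω.trans hiω
    have h1 : ENNReal.ofReal (c * i ^ (-θ)) * ENNReal.ofReal i ≤ ENNReal.ofReal T := by
      rw [← hint, hi, ENNReal.ofReal_toReal hfin, ← hi, ← lintegral_const_mul'' _ hmeas]
      refine lintegral_mono fun x => ?_
      refine le_trans ?_ (hG.GStar_le_localEnergy hd hα hwm hw0 huw hiω.le
        (by rw [hi, ENNReal.ofReal_toReal hfin]) x)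
      rw [← ENNReal.ofReal_mul (by positivity)]
      refine ENNReal.ofReal_le_ofReal ?_
      have h2 := hG.GStar_mul_le hd hα (l := 8) (t := w x / 8) (by norm_num)
        (by have := hw0 x; positivity)
      rw [mul_div_cancel₀ _ (by norm_num : (8 : ℝ) ≠ 0), ← hκ] at h2
      have h3 : (ω / i) ^ θ = ω ^ θ * i ^ (-θ) := by
        rw [Real.div_rpow hω.le hi0.le, Real.rpow_neg hi0.le, div_eq_mul_inv]
      rw [← hωd, ← hθ, h3]
      calc c * i ^ (-θ) * GStar d α g (w x)
          ≤ c * i ^ (-θ) * (8 ^ κ * GStar d α g (w x / 8)) := by gcongr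
        _ = _ := by rw [hc]; field_simp
    rw [← ENNReal.ofReal_mul (by positivity), ENNReal.ofReal_le_ofReal_iff hT0] at h1
    have h2 : i ^ (1 - θ) ≤ T / c := by
      rw [le_div_iff₀ hc0, sub_eq_neg_add, Real.rpow_add_one hi0.ne']
      linarith
    have h3 := Real.rpow_le_rpow (by positivity) h2
      (show 0 ≤ 1 / (1 - θ) from one_div_nonneg.2 (by linarith))
    rwa [← Real.rpow_mul hi0.le, mul_one_div_cancel (by linarith), Real.rpow_one] at h3
  have hlim : Tendsto (fun N : ℕ => ∫⁻ x, ENNReal.ofReal (GStar d α g (min |u x| N))) atTop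
      (𝓝 (∫⁻ x, ENNReal.ofReal (GStar d α g (u x)))) := by
    refine lintegral_tendsto_of_tendsto_of_monotone
      (fun N => (hcont.measurable.comp_aemeasurable
        (hum.abs.min aemeasurable_const)).ennreal_ofReal)
      (Eventually.of_forall fun x m n hmn => ?_) (Eventually.of_forall fun x => ?_)
    · refine ENNReal.ofReal_le_ofReal (hG.GStar_le hd hα ?_)
      have h1 : ∀ k : ℕ, 0 ≤ min |u x| (k : ℝ) := fun k => le_min (abs_nonneg _) (Nat.cast_nonneg k)
      rw [abs_of_nonneg (h1 m), abs_of_nonneg (h1 n)]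
      gcongr
    · obtain ⟨n, hn⟩ := exists_nat_ge |u x|
      refine tendsto_const_nhds.congr' ?_
      filter_upwards [eventually_ge_atTop n] with m hm
      rw [min_eq_left (hn.trans (by exact_mod_cast hm)), GStar_abs]
  refine ⟨(hcont.measurable.comp_aemeasurable hum).aestronglyMeasurable, ?_⟩
  rw [hasFiniteIntegral_iff_ofReal (Eventually.of_forall fun x => GStar_nonneg _)]
  exact (le_of_tendsto' hlim bound).trans_lt ENNReal.ofReal_lt_top

end Embedding

/-! ### Differentiability of the energy -/

section Derivative
variable {d : ℕ} {α : ℝ} {g : ℝ → ℝ} {gm gp : ℝ} {K : E d → ℝ} {f : E d → ℝ → ℝ}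

theorem fracQuot_add_smul (u v : E d → ℝ) (s : ℝ) (p : E d × E d) :
    fracQuot α (u + s • v) p = fracQuot α u p + s * fracQuot α v p := by
  simp only [fracQuot, Pi.add_apply, Pi.smul_apply, smul_eq_mul]
  ring

theorem fracQuot_smul (u : E d → ℝ) (t : ℝ) (p : E d × E d) :
    fracQuot α (t • u) p = t * fracQuot α u p := by
  simp only [fracQuot, Pi.smul_apply, smul_eq_mul]
  ring

theorem aemeasurable_fracQuot {u : E d → ℝ} (hu : AEMeasurable u) :
    AEMeasurable (fracQuot α u) (volume.prod volume) :=
  (hu.comp_fst.sub hu.comp_snd).div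
    ((measurable_fst.sub measurable_snd).norm.pow_const α).aemeasurable

theorem HypG.bigG_mul_le_max (hG : HypG d α g gm gp) (t s : ℝ) :
    bigG g (t * s) ≤ max 1 |t| ^ gp * bigG g s := by
  rw [← hG.bigG_abs s]
  refine le_trans (hG.bigG_le ?_) (hG.bigG_mul_le (le_max_left _ _) (abs_nonneg s))
  have h0 : (0 : ℝ) ≤ max 1 |t| := zero_le_one.trans (le_max_left _ _)
  rw [abs_mul, abs_mul, abs_abs, abs_of_nonneg h0]
  gcongr
  exact le_max_right _ _

theorem HypG.smul_mem_W (hG : HypG d α g gm gp) {u : E d → ℝ} (hu : u ∈ W d α g) (t : ℝ) :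
    t • u ∈ W d α g := by
  obtain ⟨h1, h2, h3⟩ := hu
  have hm := h1.const_smul t
  refine ⟨hm, ?_, ?_⟩
  · refine (h2.const_mul (max 1 |t| ^ gp)).mono'
      (hG.measurable_bigG.comp_aemeasurable hm).aestronglyMeasurable
      (Eventually.of_forall fun x => ?_)
    rw [Real.norm_of_nonneg (hG.bigG_nonneg _)]
    exact hG.bigG_mul_le_max _ _
  · refine (h3.const_mul (max 1 |t| ^ gp)).mono'
      ((hG.measurable_bigG.comp_aemeasurable (aemeasurable_fracQuot hm)).div
        (by fun_prop)).aestronglyMeasurable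
      (Eventually.of_forall fun p => ?_)
    rw [Real.norm_of_nonneg (div_nonneg (hG.bigG_nonneg _) (by positivity)), fracQuot_smul,
      ← mul_div_assoc]
    gcongr
    exact hG.bigG_mul_le_max _ _

/-- Differentiation of a modular `∫ G(a + s b) w` at `s = 0`. -/
theorem HypG.hasDerivAt_modular (hG : HypG d α g gm gp) {X : Type*} [MeasurableSpace X]
    {μ : Measure X} {a b w : X → ℝ} (ha : AEMeasurable a μ) (hb : AEMeasurable b μ)
    (hw : AEMeasurable w μ) (hw0 : ∀ x, 0 ≤ w x) (hai : Integrable (fun x => bigG g (a x) / w x) μ)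
    (hbi : Integrable (fun x => bigG g (b x) / w x) μ) :
    Integrable (fun x => g (a x) * b x / w x) μ ∧
      HasDerivAt (fun s : ℝ => ∫ x, bigG g (a x + s * b x) / w x ∂μ)
        (∫ x, g (a x) * b x / w x ∂μ) 0 := by
  have hgm := hG.cont.measurable
  have key := hasDerivAt_integral_of_dominated_loc_of_deriv_le (μ := μ) (x₀ := (0 : ℝ))
    (F := fun s x => bigG g (a x + s * b x) / w x)
    (F' := fun s x => g (a x + s * b x) * b x / w x)
    (bound := fun x => gp * 2 ^ gp * (bigG g (a x) / w x + bigG g (b x) / w x))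
    (Metric.ball_mem_nhds 0 one_pos)
    (Eventually.of_forall fun s => ((hG.measurable_bigG.comp_aemeasurable
      (ha.add (hb.const_mul s))).div hw).aestronglyMeasurable)
    (by simpa using hai)
    (((hgm.comp_aemeasurable (ha.add (hb.const_mul 0))).mul hb).div hw).aestronglyMeasurable
    (Eventually.of_forall fun x s hs => by
      rw [norm_div, Real.norm_eq_abs, Real.norm_of_nonneg (hw0 x), ← add_div, ← mul_div_assoc]
      have := hw0 x
      gcongr
      refine hG.abs_g_mul_le ?_
      rw [mem_ball_zero_iff, Real.norm_eq_abs] at hs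
      exact hs.le)
    ((hai.add hbi).const_mul _)
    (Eventually.of_forall fun x s _ => by
      have h1 : HasDerivAt (fun s : ℝ => a x + s * b x) (b x) s := by
        simpa using ((hasDerivAt_id s).mul_const (b x)).const_add (a x)
      exact ((hG.hasDerivAt (a x + s * b x)).comp s h1).div_const (w x))
  simpa using key

theorem HypK.exists_bound (hK : HypK d K) : ∃ B, 0 < B ∧ ∀ᵐ x, K x ≤ B := by
  have h1 : eLpNormEssSup K volume ≠ ⊤ := by
    have := hK.bdd.2.ne
    rwa [eLpNorm_exponent_top] at this
  refine ⟨(eLpNormEssSup K volume).toReal + 1, by positivity, ?_⟩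
  filter_upwards [ae_le_eLpNormEssSup (f := K) (μ := volume)] with x hx
  have h2 := ENNReal.toReal_mono h1 hx
  rw [toReal_enorm, Real.norm_of_nonneg (hK.pos x).le] at h2
  linarith

theorem HypF.aemeasurable_comp (hf : HypF d α g gp f) {w : E d → ℝ} (hw : AEMeasurable w) :
    AEMeasurable fun x => f x (w x) :=
  hf.meas.comp_aemeasurable (aemeasurable_id.prodMk hw)

/-- Rescaling the primitive to the fixed interval `[0, 1]` makes its measurability a case of
Fubini's theorem. -/
theorem HypF.aestronglyMeasurable_bigF (hf : HypF d α g gp f) {w : E d → ℝ}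
    (hw : AEMeasurable w) : AEStronglyMeasurable (fun x => bigF f x (w x)) := by
  have h1 : StronglyMeasurable fun p : E d × ℝ => f p.1 (p.2 * hw.mk w p.1) * hw.mk w p.1 := by
    have hm : Measurable fun p : E d × ℝ => hw.mk w p.1 := hw.measurable_mk.comp measurable_fst
    exact ((hf.meas.comp (measurable_fst.prodMk (measurable_snd.mul hm))).mul hm).stronglyMeasurable
  refine ⟨_, h1.integral_prod_right' (ν := volume.restrict (Ioc (0 : ℝ) 1)), ?_⟩
  filter_upwards [hw.ae_eq_mk] with x hx
  rw [bigF, integral_eq_ray, intervalIntegral.integral_of_le zero_le_one, hx]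

theorem HypF.hasDerivAt_bigF (hG : HypG d α g gm gp) (hd : 3 ≤ d) (hα : α ∈ Ioo (0 : ℝ) 1)
    (hK : HypK d K) (hf : HypF d α g gp f) {u v : E d → ℝ} (hu : u ∈ W d α g) (hv : v ∈ W d α g) :
    Integrable (fun x => K x * bigF f x (u x)) ∧ Integrable (fun x => K x * f x (u x) * v x) ∧
      HasDerivAt (fun s : ℝ => ∫ x, K x * bigF f x (u x + s * v x))
        (∫ x, K x * f x (u x) * v x) 0 := by
  obtain ⟨C, hC, hdom⟩ := hf.exists_dom hG hd hα
  obtain ⟨B, hB, hKB⟩ := hK.exists_bound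
  have hp : 0 < gp - 1 := by linarith [hG.gp_mem.1]
  have hKm : AEStronglyMeasurable K volume := hK.cont.aestronglyMeasurable
  have hint : ∀ {u v : E d → ℝ}, u ∈ W d α g → v ∈ W d α g → Integrable (fun x =>
      B * (C * ((bigG g (u x) + bigG g (v x)) + (GStar d α g (u x) + GStar d α g (v x))))) :=
    fun hu hv => (((hu.2.1.add hv.2.1).add ((hG.integrable_GStar hd hα hu).add
      (hG.integrable_GStar hd hα hv))).const_mul C).const_mul B
  have hF : Integrable (fun x => K x * bigF f x (u x)) := by
    refine (hint hu hu).mono' (hKm.mul (hf.aestronglyMeasurable_bigF hu.1)) ?_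
    filter_upwards [hdom, hKB, hf.isSuperpower] with x h1 h2 h3
    obtain ⟨h4, h5⟩ := h3.integral_le hp (u x)
    have h6 := h1 (u x) (u x) 0 (by simp)
    rw [zero_mul, add_zero, abs_of_nonneg (h3.nonneg _)] at h6
    rw [norm_mul, Real.norm_of_nonneg (hK.pos x).le, bigF, Real.norm_of_nonneg h4]
    have h7 : ∫ t in (0 : ℝ)..u x, f x t ≤ f x (u x) * u x := by nlinarith
    gcongr
    exact h7.trans h6
  have key := hasDerivAt_integral_of_dominated_loc_of_deriv_le (μ := volume) (x₀ := (0 : ℝ))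
    (F := fun s x => K x * bigF f x (u x + s * v x))
    (F' := fun s x => K x * f x (u x + s * v x) * v x)
    (Metric.ball_mem_nhds 0 one_pos)
    (Eventually.of_forall fun s => hKm.mul
      (hf.aestronglyMeasurable_bigF (hu.1.add (hv.1.const_mul s))))
    (by simpa using hF)
    ((hKm.aemeasurable.mul (hf.aemeasurable_comp (hu.1.add (hv.1.const_mul 0)))).mul
      hv.1).aestronglyMeasurable
    (by
      filter_upwards [hdom, hKB] with x h1 h2 s hs
      rw [mem_ball_zero_iff, Real.norm_eq_abs] at hs
      have h3 := h1 (u x) (v x) s hs.le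
      rw [mul_assoc, norm_mul, Real.norm_of_nonneg (hK.pos x).le, Real.norm_eq_abs]
      gcongr)
    (hint hu hv)
    (by
      filter_upwards [hf.isSuperpower] with x hx s _
      have h1 : HasDerivAt (fun s : ℝ => u x + s * v x) (v x) s := by
        simpa using ((hasDerivAt_id s).mul_const (v x)).const_add (u x)
      have h2 : HasDerivAt (bigF f x) (f x (u x + s * v x)) (u x + s * v x) :=
        intervalIntegral.integral_hasDerivAt_right (hx.cont.intervalIntegrable _ _)
          (hx.cont.stronglyMeasurableAtFilter _ _) hx.cont.continuousAt
      rw [mul_assoc]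
      exact (h2.comp s h1).const_mul (K x))
  refine ⟨hF, ?_⟩
  simpa using key

theorem HypF.hasDerivAt_J (hG : HypG d α g gm gp) (hd : 3 ≤ d) (hα : α ∈ Ioo (0 : ℝ) 1)
    (hK : HypK d K) (hf : HypF d α g gp f) {u v : E d → ℝ} (hu : u ∈ W d α g) (hv : v ∈ W d α g) :
    Integrable (fun p : E d × E d => g (fracQuot α u p) * fracQuot α v p / ‖p.1 - p.2‖ ^ d)
        (volume.prod volume) ∧
      Integrable (fun x => g (u x) * v x) ∧
      Integrable (fun x => K x * f x (u x) * v x) ∧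
      HasDerivAt (fun s : ℝ => J α g K f (u + s • v)) (dJ α g K f u v) 0 := by
  obtain ⟨i1, D1⟩ := hG.hasDerivAt_modular (aemeasurable_fracQuot hu.1)
    (aemeasurable_fracQuot (α := α) hv.1) (w := fun p : E d × E d => ‖p.1 - p.2‖ ^ d)
    (by fun_prop) (fun p => by positivity) hu.2.2 hv.2.2
  obtain ⟨i2, D2⟩ := hG.hasDerivAt_modular hu.1 hv.1 (w := fun _ => 1) aemeasurable_const
    (fun _ => zero_le_one) (by simpa using hu.2.1) (by simpa using hv.2.1)
  obtain ⟨-, i3, D3⟩ := HypF.hasDerivAt_bigF hG hd hα hK hf hu hv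
  simp only [div_one] at i2 D2
  refine ⟨i1, i2, i3, ?_⟩
  have := (D1.add D2).sub D3
  refine this.congr_of_eventuallyEq (Eventually.of_forall fun s => ?_)
  simp only [J, fracQuot_add_smul, Pi.add_apply, Pi.sub_apply, Pi.smul_apply, smul_eq_mul]

end Derivative

/-! ### The fibering map -/

section Fibering
variable {d : ℕ} {α : ℝ} {g : ℝ → ℝ} {gm gp : ℝ} {K : E d → ℝ} {f : E d → ℝ → ℝ}

theorem HypF.hasDerivAt_fiber (hG : HypG d α g gm gp) (hd : 3 ≤ d) (hα : α ∈ Ioo (0 : ℝ) 1)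
    (hK : HypK d K) (hf : HypF d α g gp f) {u : E d → ℝ} (hu : u ∈ W d α g) (t : ℝ) :
    HasDerivAt (fun s : ℝ => J α g K f (s • u)) (dJ α g K f (t • u) u) t := by
  have h1 := (HypF.hasDerivAt_J hG hd hα hK hf (hG.smul_mem_W hu t) hu).2.2.2
  rw [← sub_self t] at h1
  have h2 := h1.comp_sub_const t t
  simpa only [← add_smul, add_sub_cancel] using h2

theorem dJ_smul_right (u v : E d → ℝ) (t : ℝ) :
    dJ α g K f u (t • v) = t * dJ α g K f u v := by
  simp only [dJ, fracQuot_smul, Pi.smul_apply, smul_eq_mul]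
  rw [mul_sub, mul_add, ← integral_const_mul, ← integral_const_mul, ← integral_const_mul]
  congr 1
  · congr 1 <;> · congr 1; ext; ring
  · congr 1; ext; ring

/-- The slope `⟨J'(tu), u⟩ / t^{g⁺-1}` of the fibering map, normalised by the power that separates
the growth of `g` from that of `f`. -/
def fiberSlope (α : ℝ) (g : ℝ → ℝ) (gp : ℝ) (K : E d → ℝ) (f : E d → ℝ → ℝ) (u : E d → ℝ)
    (t : ℝ) : ℝ :=
  dJ α g K f (t • u) u / t ^ (gp - 1)

/-- The integrals composing the normalised slope, with their integrability. -/
theorem HypF.fiberSlope_eq (hG : HypG d α g gm gp) (hd : 3 ≤ d) (hα : α ∈ Ioo (0 : ℝ) 1)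
    (hK : HypK d K) (hf : HypF d α g gp f) {u : E d → ℝ} (hu : u ∈ W d α g) (t : ℝ) :
    Integrable (fun p : E d × E d => g (t * fracQuot α u p) * fracQuot α u p / t ^ (gp - 1) /
        ‖p.1 - p.2‖ ^ d) (volume.prod volume) ∧
      Integrable (fun x => g (t * u x) * u x / t ^ (gp - 1)) ∧
      Integrable (fun x => K x * (f x (t * u x) * u x / t ^ (gp - 1))) ∧
      fiberSlope α g gp K f u t =
        (∫ p : E d × E d, g (t * fracQuot α u p) * fracQuot α u p / t ^ (gp - 1) /
          ‖p.1 - p.2‖ ^ d ∂(volume.prod volume)) + (∫ x, g (t * u x) * u x / t ^ (gp - 1)) -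
        ∫ x, K x * (f x (t * u x) * u x / t ^ (gp - 1)) := by
  obtain ⟨i1, i2, i3, -⟩ := HypF.hasDerivAt_J hG hd hα hK hf (hG.smul_mem_W hu t) hu
  have e1 : ∀ p : E d × E d, g (t * fracQuot α u p) * fracQuot α u p / t ^ (gp - 1) /
        ‖p.1 - p.2‖ ^ d = g (t * fracQuot α u p) * fracQuot α u p / ‖p.1 - p.2‖ ^ d /
        t ^ (gp - 1) := fun p => div_right_comm _ _ _
  have e3 : ∀ x, K x * (f x (t * u x) * u x / t ^ (gp - 1)) =
      K x * f x (t * u x) * u x / t ^ (gp - 1) := fun x => by ring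
  simp only [fracQuot_smul, Pi.smul_apply, smul_eq_mul] at i1 i2 i3
  simp only [e1, e3]
  refine ⟨i1.div_const _, i2.div_const _, i3.div_const _, ?_⟩
  rw [integral_div, integral_div, integral_div, ← add_div, ← sub_div, fiberSlope, dJ]
  simp only [fracQuot_smul, Pi.smul_apply, smul_eq_mul]

theorem measure_ne_zero_of_not_ae_eq {u : E d → ℝ} (h0 : ¬ (u =ᵐ[volume] 0)) :
    volume {x | u x ≠ 0} ≠ 0 := fun h => h0 (by rw [EventuallyEq, ae_iff]; exact h)

/-- The parts coming from `g` are nonincreasing; the part coming from `f` is strictly increasing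
because `K > 0` and `u ≠ 0` on a set of positive measure. -/
theorem HypF.strictAntiOn_fiberSlope (hG : HypG d α g gm gp) (hd : 3 ≤ d)
    (hα : α ∈ Ioo (0 : ℝ) 1) (hK : HypK d K) (hf : HypF d α g gp f) {u : E d → ℝ}
    (hu : u ∈ W d α g) (h0 : ¬ (u =ᵐ[volume] 0)) :
    StrictAntiOn (fiberSlope α g gp K f u) (Ioi 0) := by
  intro s hs t ht hst
  obtain ⟨i1, i2, i3, e⟩ := HypF.fiberSlope_eq hG hd hα hK hf hu s
  obtain ⟨j1, j2, j3, e'⟩ := HypF.fiberSlope_eq hG hd hα hK hf hu t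
  rw [e, e']
  have k1 := integral_mono j1 i1 fun p =>
    div_le_div_of_nonneg_right (hG.antitoneOn_ray (fracQuot α u p) hs ht hst.le)
      (by positivity)
  have k2 := integral_mono j2 i2 fun x => hG.antitoneOn_ray (u x) hs ht hst.le
  have k3 : ∫ x, K x * (f x (s * u x) * u x / s ^ (gp - 1)) <
      ∫ x, K x * (f x (t * u x) * u x / t ^ (gp - 1)) := by
    rw [← sub_pos, ← integral_sub j3 i3]
    refine (integral_pos_iff_support_of_nonneg_ae ?_ (j3.sub i3)).2
      (pos_iff_ne_zero.2 fun h => measure_ne_zero_of_not_ae_eq h0 (measure_mono_null_ae ?_ h))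
    · filter_upwards [hf.isSuperpower] with x hx
      exact sub_nonneg.2 (mul_le_mul_of_nonneg_left (hx.ray_le _ hs hst.le) (hK.pos x).le)
    · filter_upwards [hf.isSuperpower] with x hx hux
      exact (sub_pos.2 (mul_lt_mul_of_pos_left (hx.ray _ hux _ _ hs hst) (hK.pos x))).ne'
  linarith

theorem HypG.integral_g_mul_pos (hG : HypG d α g gm gp) {u : E d → ℝ}
    (hi : Integrable fun x => g (u x) * u x) (h0 : ¬ (u =ᵐ[volume] 0)) :
    0 < ∫ x, g (u x) * u x := by
  rw [integral_pos_iff_support_of_nonneg (fun x => hG.g_mul_nonneg _) hi]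
  refine pos_iff_ne_zero.2 fun h => measure_ne_zero_of_not_ae_eq h0 (measure_mono_null ?_ h)
  intro x hx
  exact (hG.g_mul_pos hx).ne'

/-- Near `t = 0` the normalised slope is positive: the integrand coming from `f` is eventually
absorbed pointwise by the one coming from `g`. -/
theorem HypF.exists_fiberSlope_pos (hG : HypG d α g gm gp) (hd : 3 ≤ d)
    (hα : α ∈ Ioo (0 : ℝ) 1) (hK : HypK d K) (hf : HypF d α g gp f) {u : E d → ℝ}
    (hu : u ∈ W d α g) (h0 : ¬ (u =ᵐ[volume] 0)) :
    ∃ t, 0 < t ∧ 0 < fiberSlope α g gp K f u t := by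
  obtain ⟨-, i2, i3, -⟩ := HypF.fiberSlope_eq hG hd hα hK hf hu 1
  simp only [Real.one_rpow, div_one, one_mul] at i2 i3
  obtain ⟨B, hB, hKB⟩ := hK.exists_bound
  obtain ⟨δ, hδ, hfδ⟩ := hf.at_zero (1 / (2 * B)) (by positivity)
  set ψ : ℝ → E d → ℝ := fun t x => g (t * u x) * u x / t ^ (gp - 1) -
    K x * (f x (t * u x) * u x / t ^ (gp - 1)) with hψ
  have hψi : ∀ t, Integrable (ψ t) := fun t => by
    obtain ⟨-, j2, j3, -⟩ := HypF.fiberSlope_eq hG hd hα hK hf hu t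
    exact j2.sub j3
  have hlim : Tendsto (fun t : ℝ => ∫ x, min (ψ t x) (g (u x) * u x / 2)) (𝓝[>] 0)
      (𝓝 (∫ x, g (u x) * u x / 2)) := by
    refine tendsto_integral_filter_of_dominated_convergence
      (fun x => g (u x) * u x + K x * (f x (u x) * u x))
      (Eventually.of_forall fun t => ((hψi t).inf (i2.div_const 2)).aestronglyMeasurable)
      ?_ (i2.add i3) ?_
    · filter_upwards [Ioc_mem_nhdsGT (show (0 : ℝ) < 1 from one_pos)] with t ht
      filter_upwards [hf.isSuperpower] with x hx
      have h1 : g (1 * u x) * u x / 1 ^ (gp - 1) ≤ g (t * u x) * u x / t ^ (gp - 1) :=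
        hG.antitoneOn_ray (u x) ht.1 (mem_Ioi.2 one_pos) ht.2
      have h2 := mul_le_mul_of_nonneg_left (hx.ray_le (u x) ht.1 ht.2) (hK.pos x).le
      simp only [Real.one_rpow, div_one, one_mul] at h1 h2
      have h3 := hG.g_mul_nonneg (u x)
      have h4 := mul_nonneg (hK.pos x).le (hx.nonneg (u x))
      rw [Real.norm_eq_abs, abs_le]
      refine ⟨le_min ?_ (by linarith), (min_le_right _ _).trans (by linarith)⟩
      simp only [hψ]
      linarith
    · filter_upwards [hf.isSuperpower, hKB, hfδ] with x hx hKx hδx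
      refine tendsto_const_nhds.congr' ?_
      rcases eq_or_ne (u x) 0 with hux | hux
      · exact Eventually.of_forall fun t => by simp [hψ, hux]
      have hu0 := abs_pos.2 hux
      filter_upwards [Ioc_mem_nhdsGT (show (0 : ℝ) < 1 from one_pos),
        Ioo_mem_nhdsGT (show 0 < δ / |u x| by positivity)] with t ht ht'
      refine (min_eq_right ?_).symm
      have ht0 := ht.1
      have h1 : g (1 * u x) * u x / 1 ^ (gp - 1) ≤ g (t * u x) * u x / t ^ (gp - 1) :=
        hG.antitoneOn_ray (u x) ht.1 (mem_Ioi.2 one_pos) ht.2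
      simp only [Real.one_rpow, div_one, one_mul] at h1
      have htu : t * u x ≠ 0 := mul_ne_zero ht0.ne' hux
      have h2 := hδx (t * u x) (abs_pos.2 htu) (by
        rw [abs_mul, abs_of_pos ht0]
        exact (lt_div_iff₀ hu0).1 ht'.2)
      have hgp := hG.g_mul_pos htu
      have hfp := hx.pos _ htu
      rw [← mul_div_mul_right _ _ htu, abs_of_pos (by positivity), div_lt_iff₀ hgp] at h2
      have h3 : f x (t * u x) * u x ≤ 1 / (2 * B) * (g (t * u x) * u x) := by
        refine le_of_mul_le_mul_left ?_ ht0
        linarith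
      have h4 : K x * (f x (t * u x) * u x / t ^ (gp - 1)) ≤
          1 / 2 * (g (t * u x) * u x / t ^ (gp - 1)) := by
        have h5 : 0 < t ^ (gp - 1) := Real.rpow_pos_of_pos ht0 _
        have h6 : 0 ≤ f x (t * u x) * u x := by
          refine nonneg_of_mul_nonneg_right (a := t) ?_ ht0
          linarith
        calc K x * (f x (t * u x) * u x / t ^ (gp - 1))
            ≤ B * (1 / (2 * B) * (g (t * u x) * u x) / t ^ (gp - 1)) := by gcongr
          _ = _ := by field_simp
      simp only [hψ]
      linarith
  have hpos : 0 < ∫ x, g (u x) * u x / 2 := by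
    rw [integral_div]
    exact half_pos (hG.integral_g_mul_pos i2 h0)
  obtain ⟨t, ht, ht0⟩ := ((hlim.eventually (lt_mem_nhds hpos)).and self_mem_nhdsWithin).exists
  refine ⟨t, ht0, ?_⟩
  obtain ⟨-, j2, j3, e⟩ := HypF.fiberSlope_eq hG hd hα hK hf hu t
  have h1 : 0 ≤ ∫ p : E d × E d, g (t * fracQuot α u p) * fracQuot α u p / t ^ (gp - 1) /
      ‖p.1 - p.2‖ ^ d ∂(volume.prod volume) := integral_nonneg fun p => by
    have h2 : 0 ≤ g (t * fracQuot α u p) * fracQuot α u p := by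
      refine nonneg_of_mul_nonneg_right (a := t) ?_ ht0
      linarith [hG.g_mul_nonneg (t * fracQuot α u p)]
    have h3 : 0 < t ^ (gp - 1) := Real.rpow_pos_of_pos ht0 _
    positivity
  have h2 : ∫ x, min (ψ t x) (g (u x) * u x / 2) ≤ ∫ x, ψ t x :=
    integral_mono ((hψi t).inf (i2.div_const 2)) (hψi t) fun x => min_le_left _ _
  have h3 : ∫ x, ψ t x = _ := integral_sub j2 j3
  rw [e]
  linarith

/-- For large `t` the normalised slope is negative, by the superlinear growth of `F`. -/
theorem HypF.exists_fiberSlope_neg (hG : HypG d α g gm gp) (hd : 3 ≤ d)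
    (hα : α ∈ Ioo (0 : ℝ) 1) (hK : HypK d K) (hf : HypF d α g gp f) {u : E d → ℝ}
    (hu : u ∈ W d α g) (h0 : ¬ (u =ᵐ[volume] 0)) :
    ∃ t, 0 < t ∧ fiberSlope α g gp K f u t < 0 := by
  have hp : 0 < gp - 1 := by linarith [hG.gp_mem.1]
  obtain ⟨i1, i2, -, -⟩ := HypF.fiberSlope_eq hG hd hα hK hf hu 1
  have i2' := i2
  simp only [Real.one_rpow, div_one, one_mul] at i2'
  have hpos := hG.integral_g_mul_pos i2' h0
  set A := (∫ p : E d × E d, g (1 * fracQuot α u p) * fracQuot α u p / 1 ^ (gp - 1) /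
      ‖p.1 - p.2‖ ^ d ∂(volume.prod volume)) + (∫ x, g (1 * u x) * u x / 1 ^ (gp - 1)) with hA
  set P := ∫ x, g (u x) * u x with hP
  -- the level at which the `f`-integrand is truncated: its integral `c P` exceeds `A`
  set c := |A| / P + 1 with hc
  have hcP : A < c * P := by
    rw [hc, add_mul, div_mul_cancel₀ _ hpos.ne']
    linarith [le_abs_self A]
  have hc0 : 0 < c := by positivity
  have hi : ∀ t, Integrable fun x => K x * (f x (t * u x) * u x / t ^ (gp - 1)) := fun t =>
    (HypF.fiberSlope_eq hG hd hα hK hf hu t).2.2.1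
  choose R hR0 hR using hf.superlinear
  -- the threshold needed at `x` depends on `x`, so the a.e. statement is taken for all natural `M`
  have hlim : Tendsto (fun t : ℝ => ∫ x, min (K x * (f x (t * u x) * u x / t ^ (gp - 1)))
      (c * (g (u x) * u x))) atTop (𝓝 (∫ x, c * (g (u x) * u x))) := by
    refine tendsto_integral_filter_of_dominated_convergence
      (fun x => c * (g (u x) * u x))
      (Eventually.of_forall fun t => ((hi t).inf (i2'.const_mul c)).aestronglyMeasurable)
      ?_ (i2'.const_mul c) ?_
    · filter_upwards [eventually_gt_atTop 0] with t ht
      filter_upwards [hf.isSuperpower] with x hx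
      have h3 := mul_nonneg hc0.le (hG.g_mul_nonneg (u x))
      have h4 : 0 ≤ f x (t * u x) * u x := by
        refine nonneg_of_mul_nonneg_right (a := t) ?_ ht
        linarith [hx.nonneg (t * u x)]
      have h5 : 0 < t ^ (gp - 1) := Real.rpow_pos_of_pos ht _
      have h6 := hK.pos x
      rw [Real.norm_of_nonneg (le_min (by positivity) h3)]
      exact min_le_right _ _
    · filter_upwards [hf.isSuperpower, ae_all_iff.2 fun n : ℕ => hR n] with x hx hRx
      refine tendsto_const_nhds.congr' ?_
      rcases eq_or_ne (u x) 0 with hux | hux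
      · exact Eventually.of_forall fun t => by simp [hux]
      have hu0 := abs_pos.2 hux
      have hK0 := hK.pos x
      have hup : 0 < |u x| ^ gp := Real.rpow_pos_of_pos hu0 _
      obtain ⟨n, hn⟩ := exists_nat_ge (c * (g (u x) * u x) / (K x * |u x| ^ gp))
      rw [div_le_iff₀ (by positivity)] at hn
      filter_upwards [eventually_gt_atTop (R n / |u x|)] with t ht
      refine (min_eq_right (hn.trans ?_)).symm
      have ht0 : 0 < t := (div_pos (hR0 n) hu0).trans ht
      rw [div_lt_iff₀ hu0] at ht
      have h1 := hRx n (t * u x) (by rwa [abs_mul, abs_of_pos ht0])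
      have htp : 0 < t ^ (gp - 1) := Real.rpow_pos_of_pos ht0 _
      rw [abs_mul, abs_of_pos ht0, Real.mul_rpow ht0.le hu0.le,
        lt_div_iff₀ (by have := Real.rpow_pos_of_pos ht0 gp; positivity)] at h1
      obtain ⟨h2, h3⟩ := hx.integral_le hp (t * u x)
      rw [bigF] at h1
      have h4 : t ^ gp = t ^ (gp - 1) * t := by rw [Real.rpow_sub_one ht0.ne']; field_simp
      have h5 : n * |u x| ^ gp * t ^ (gp - 1) ≤ f x (t * u x) * u x := by
        refine le_of_mul_le_mul_right ?_ ht0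
        rw [h4] at h1
        nlinarith
      have h6 : n * |u x| ^ gp ≤ f x (t * u x) * u x / t ^ (gp - 1) := (le_div_iff₀ htp).2 h5
      calc n * (K x * |u x| ^ gp) = K x * (n * |u x| ^ gp) := by ring
        _ ≤ _ := by gcongr
  rw [integral_const_mul, ← hP] at hlim
  obtain ⟨t, ht, ht1⟩ := ((hlim.eventually (lt_mem_nhds hcP)).and (eventually_ge_atTop 1)).exists
  have ht0 : 0 < t := one_pos.trans_le ht1
  refine ⟨t, ht0, ?_⟩
  obtain ⟨j1, j2, j3, e⟩ := HypF.fiberSlope_eq hG hd hα hK hf hu t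
  have k1 := integral_mono j1 i1 fun p =>
    div_le_div_of_nonneg_right (hG.antitoneOn_ray (fracQuot α u p)
      (show (0 : ℝ) < 1 from one_pos) ht0 ht1) (by positivity)
  have k2 := integral_mono j2 i2 fun x =>
    hG.antitoneOn_ray (u x) (show (0 : ℝ) < 1 from one_pos) ht0 ht1
  have k3 := integral_mono ((hi t).inf (i2'.const_mul c)) (hi t) fun x => min_le_left _ _
  have k3' : ∫ x, min (K x * (f x (t * u x) * u x / t ^ (gp - 1))) (c * (g (u x) * u x)) ≤
    ∫ x, K x * (f x (t * u x) * u x / t ^ (gp - 1)) := k3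
  rw [e]
  linarith

theorem HypF.smul_mem_Nehari_iff (hG : HypG d α g gm gp) {u : E d → ℝ}
    (hu : u ∈ W d α g) (h0 : ¬ (u =ᵐ[volume] 0)) {t : ℝ} (ht : 0 < t) :
    t • u ∈ Nehari α g K f ↔ fiberSlope α g gp K f u t = 0 := by
  have hne : ¬ (t • u =ᵐ[volume] 0) := fun h => h0 (by
    filter_upwards [h] with x hx
    simpa [ht.ne'] using hx)
  have htp : t ^ (gp - 1) ≠ 0 := (Real.rpow_pos_of_pos ht _).ne'
  simp [Nehari, hG.smul_mem_W hu t, hne, dJ_smul_right, fiberSlope, ht.ne', htp]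

theorem HypF.existsUnique_smul_mem_Nehari (hG : HypG d α g gm gp) (hd : 3 ≤ d)
    (hα : α ∈ Ioo (0 : ℝ) 1) (hK : HypK d K) (hf : HypF d α g gp f) {u : E d → ℝ}
    (hu : u ∈ W d α g) (h0 : ¬ (u =ᵐ[volume] 0)) :
    ∃! t : ℝ, 0 < t ∧ t • u ∈ Nehari α g K f := by
  have hanti := HypF.strictAntiOn_fiberSlope hG hd hα hK hf hu h0
  obtain ⟨a, ha, hpos⟩ := HypF.exists_fiberSlope_pos hG hd hα hK hf hu h0
  obtain ⟨b, hb, hneg⟩ := HypF.exists_fiberSlope_neg hG hd hα hK hf hu h0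
  have hab : a ≤ b := (hanti.lt_iff_gt hb ha).1 (hneg.trans hpos) |>.le
  have hap : 0 < a ^ (gp - 1) := Real.rpow_pos_of_pos ha _
  have hbp : 0 < b ^ (gp - 1) := Real.rpow_pos_of_pos hb _
  -- the slope of the fibering map is a derivative, so Darboux's theorem applies
  obtain ⟨t, ht, h⟩ := exists_hasDerivWithinAt_eq_of_lt_of_gt hab
    (fun t _ => (HypF.hasDerivAt_fiber hG hd hα hK hf hu t).hasDerivWithinAt)
    ((div_pos_iff_of_pos_right hap).1 hpos) (by
      by_contra hcon
      exact hneg.not_ge (div_nonneg (not_lt.1 hcon) hbp.le))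
  simp only at h
  have ht0 : 0 < t := ha.trans ht.1
  refine ⟨t, ⟨ht0, (HypF.smul_mem_Nehari_iff hG hu h0 ht0).2 (by rw [fiberSlope, h, zero_div])⟩, ?_⟩
  rintro s ⟨hs, hs'⟩
  refine hanti.injOn hs ht0 ?_
  rw [(HypF.smul_mem_Nehari_iff hG hu h0 hs).1 hs', fiberSlope, h, zero_div]

/-- The slope of the fibering map changes sign from positive to negative at a Nehari point. -/
theorem HypF.J_smul_le (hG : HypG d α g gm gp) (hd : 3 ≤ d)
    (hα : α ∈ Ioo (0 : ℝ) 1) (hK : HypK d K) (hf : HypF d α g gp f) {u : E d → ℝ}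
    (hu : u ∈ Nehari α g K f) {t : ℝ} (ht : 0 < t) :
    J α g K f (t • u) ≤ J α g K f u := by
  obtain ⟨huW, h0, -⟩ := id hu
  have hanti := HypF.strictAntiOn_fiberSlope hG hd hα hK hf huW h0
  have h1 : fiberSlope α g gp K f u 1 = 0 :=
    (HypF.smul_mem_Nehari_iff hG huW h0 one_pos).1 (by rwa [one_smul])
  have hD := HypF.hasDerivAt_fiber hG hd hα hK hf huW
  have hcont : Continuous fun s : ℝ => J α g K f (s • u) :=
    continuous_iff_continuousAt.2 fun s => (hD s).continuousAt
  have hsl : ∀ s, 0 < s → dJ α g K f (s • u) u = fiberSlope α g gp K f u s * s ^ (gp - 1) :=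
    fun s hs => (div_mul_cancel₀ _ (Real.rpow_pos_of_pos hs _).ne').symm
  have key : J α g K f (t • u) ≤ J α g K f ((1 : ℝ) • u) := by
    rcases le_total t 1 with h | h
    · refine monotoneOn_of_deriv_nonneg (convex_Icc t 1) hcont.continuousOn
        (fun s _ => (hD s).differentiableAt.differentiableWithinAt) (fun s hs => ?_)
        ⟨le_rfl, h⟩ ⟨h, le_rfl⟩ h
      rw [interior_Icc] at hs
      have hs0 := ht.trans hs.1
      rw [(hD s).deriv, hsl s hs0]
      have := hanti.antitoneOn hs0 (mem_Ioi.2 one_pos) hs.2.le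
      exact mul_nonneg (h1 ▸ this) (Real.rpow_nonneg hs0.le _)
    · refine antitoneOn_of_deriv_nonpos (convex_Icc 1 t) hcont.continuousOn
        (fun s _ => (hD s).differentiableAt.differentiableWithinAt) (fun s hs => ?_)
        ⟨le_rfl, h⟩ ⟨h, le_rfl⟩ h
      rw [interior_Icc] at hs
      have hs0 := one_pos.trans hs.1
      rw [(hD s).deriv, hsl s hs0]
      have := hanti.antitoneOn (mem_Ioi.2 one_pos) hs0 hs.1.le
      exact mul_nonpos_of_nonpos_of_nonneg (h1 ▸ this) (Real.rpow_nonneg hs0.le _)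
  rwa [one_smul] at key

end Fibering

end FracOrlicz

end

theorem mainTheorem6 (d : ℕ) (hd : 3 ≤ d) (α : ℝ) (hα : α ∈ Set.Ioo (0 : ℝ) 1)
    (g : ℝ → ℝ) (gm gp : ℝ) (hG : FracOrlicz.HypG d α g gm gp)
    (K : FracOrlicz.E d → ℝ) (hK : FracOrlicz.HypK d K)
    (f : FracOrlicz.E d → ℝ → ℝ) (hf : FracOrlicz.HypF d α g gp f) :
    -- `J` is well defined, and `dJ` is a convergent expression that is its derivative
    (∀ u ∈ FracOrlicz.W d α g,
      Integrable (fun x => K x * FracOrlicz.bigF f x (u x)) volume) ∧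
    (∀ u ∈ FracOrlicz.W d α g, ∀ v ∈ FracOrlicz.W d α g,
      Integrable (fun p : FracOrlicz.E d × FracOrlicz.E d =>
        g (FracOrlicz.fracQuot α u p) * FracOrlicz.fracQuot α v p / ‖p.1 - p.2‖ ^ d)
        (volume.prod volume) ∧
      Integrable (fun x => g (u x) * v x) volume ∧
      Integrable (fun x => K x * f x (u x) * v x) volume ∧
      HasDerivAt (fun s : ℝ => FracOrlicz.J α g K f (u + s • v))
        (FracOrlicz.dJ α g K f u v) 0) ∧
    -- unique projection onto the Nehari manifold
    (∀ u ∈ FracOrlicz.W d α g, ¬ (u =ᵐ[volume] 0) →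
      ∃! t : ℝ, 0 < t ∧ t • u ∈ FracOrlicz.Nehari α g K f) ∧
    -- the fibering map is maximal at `t = 1`
    (∀ u ∈ FracOrlicz.Nehari α g K f, ∀ t : ℝ, 0 < t →
      FracOrlicz.J α g K f (t • u) ≤ FracOrlicz.J α g K f u) := by
  refine ⟨fun u hu => (FracOrlicz.HypF.hasDerivAt_bigF hG hd hα hK hf hu hu).1,
    fun u hu v hv => FracOrlicz.HypF.hasDerivAt_J hG hd hα hK hf hu hv,
    fun u hu h0 => FracOrlicz.HypF.existsUnique_smul_mem_Nehari hG hd hα hK hf hu h0,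
    fun u hu t ht => FracOrlicz.HypF.J_smul_le hG hd hα hK hf hu ht⟩
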